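/- Let $I=(0,1]$ with Lebesgue measure $\lambda$ on the $\sigma$-algebra $\Lambda$ of Lebesgue measurable sets, and let $L^1=L^1(I)$, $L^\infty=L^\infty(I)$ be the real spaces. For $x\in L^1$ let $x^*(t)=\inf\{s\ge 0:\lambda\{|x|>s\}\le t\}$ be the non-increasing right-continuous rearrangement of $|x|$, $\psi_x(t)=\int_0^t x^*\,d\lambda$ and $x^{**}(t)=\psi_x(t)/t$. An *order ideal* is a vector space $L^\infty\subseteq X\subseteq L^1$ such that $x\in X$, $|y|\le|x|$ imply $y\in X$. It is *symmetric* if $x\in X$, $y\in L^1$, $y^*\le x^*$ imply $y\in X$. It is *majorant* if $TX\subseteq X$ for every bounded linear $T:L^1\to L^1$ with $TL^\infty\subseteq L^\infty$. For $f\in L^1$ let $\mathcal N_f$ (resp. $\mathcal M_f$) be the smallest symmetric (resp. majorant) ideal containing $f$. The *modular* is $$n_f(x)=\inf\{s>0:\ x^*(t)\le s\,f^*(\hat s^{-1}t)\ \text{for all } t\in I\},\qquad \hat s=\max(s,s^{-1}).$$ A *$\sigma$-subalgebra* of $\Lambda$ is a $\sigma$-algebra $\mathcal A\subseteq\Lambda$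 on $I$ containing all $\lambda$-null sets; it *averages* $X$ if the conditional expectation $E(x|\mathcal A)$ belongs to $X$ for every $x\in X$. For $f\ne0$ put $\|x\|_{M_\psi}=\sup_{t\in I}\psi_x(t)/\psi_f(t)$, and let $M_\psi$ (the Marcinkiewicz space, $\psi=\psi_f$) consist of the $x\in L^1$ with $\|x\|_{M_\psi}<\infty$. For $0<s\le1$ let $(\rho_sx)(t)=x(st)$, and $\|\rho_s\|_{M_\psi\to M_\psi}=\sup\{\|\rho_sx\|_{M_\psi}:\|x\|_{M_\psi}=1\}$. **Theorem.** Let $f\in L^1$, $f\neq0$. The following conditions are equivalent. 1. There is a norm on $\mathcal N_f$ whose topology is the one defined by the modular $n_f$, i.e. the sets $\{x\in\mathcal N_f: n_f(x)<\varepsilon\}$, $\varepsilon>0$, form a base of (not necessarily open) neighbourhoods of zero for the norm topology. 2. $\mathcal N_f=\mathcal M_f$. 3. Every $\sigma$-subalgebra of $\Lambda$ averages $\mathcal N_f$. 4. $f$ is regular, i.e. $f^{**}\in\mathcal N_f$. 5. There are $K>0$ and $\delta>0$ with $f^{**}(t)\le K f^*(t)$ for $0<t<\delta$. 6. There are $k>0$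 and $p\in(0,1)$ with $\|\rho_s\|_{M_\psi\to M_\psi}\le k\,s^{-p}$ for $0<s\le1$. 7. $\displaystyle\liminf_{t\to0+}\frac{\psi(2t)}{\psi(t)}>1$. Moreover, there is $K>0$ with $f^{**}(t)\le Kf^*(t)$ for all $t\in(0,1)$ if and only if these conditions hold and $\operatorname{ess\,inf}_I|f|>0$. -/

import Mathlib

open MeasureTheory Set Filter Topology
open scoped ENNReal

namespace MeklerIdeals

/-- Lebesgue measure on `I = (0,1]`, viewed as a measure on `ℝ` carried by `I`. -/
noncomputable abbrev lam : Measure ℝ := volume.restrict (Ioc (0 : ℝ) 1)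

/-- The real space `L¹(I)`. -/
abbrev L1 : Type := Lp ℝ 1 lam

/-- The non-increasing right-continuous rearrangement
`g*(t) = inf {s ≥ 0 : λ{|g| > s} ≤ t}`, for `t > 0`. It vanishes for `t ≥ 1`. -/
noncomputable def rearr (g : ℝ → ℝ) (t : ℝ) : ℝ :=
  sInf {s : ℝ | 0 ≤ s ∧ lam {u | s < |g u|} ≤ ENNReal.ofReal t}

/-- `ψ_g(t) = ∫₀ᵗ g* dλ`. -/
noncomputable def psi (g : ℝ → ℝ) (t : ℝ) : ℝ := ∫ u in Ioc (0 : ℝ) t, rearr g u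

/-- `g**(t) = (1/t) ∫₀ᵗ g* dλ`. -/
noncomputable def maximalFn (g : ℝ → ℝ) (t : ℝ) : ℝ := t⁻¹ * psi g t

/-- Order ideals: vector spaces `L^∞ ⊆ X ⊆ L¹` that are solid. -/
structure IsOrderIdeal (X : Submodule ℝ L1) : Prop where
  bounded_mem : ∀ x : L1, MemLp x ∞ lam → x ∈ X
  solid : ∀ x ∈ X, ∀ y : L1, |y| ≤ |x| → y ∈ X

/-- Symmetric ideals. -/
structure IsSymmetricIdeal (X : Submodule ℝ L1) : Prop extends IsOrderIdeal X where
  symm : ∀ x ∈ X, ∀ y : L1, (∀ t ∈ Ioc (0 : ℝ) 1, rearr y t ≤ rearr x t) → y ∈ X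

/-- Admissible operators: bounded on `L¹` and mapping `L^∞` into `L^∞`. -/
def IsAdmissible (T : L1 →L[ℝ] L1) : Prop :=
  ∀ x : L1, MemLp x ∞ lam → MemLp (T x) ∞ lam

/-- Majorant ideals: order ideals that are interpolation spaces between `L¹` and `L^∞`. -/
structure IsMajorantIdeal (X : Submodule ℝ L1) : Prop extends IsOrderIdeal X where
  interpolation : ∀ T : L1 →L[ℝ] L1, IsAdmissible T → ∀ x ∈ X, T x ∈ X

/-- The principal symmetric ideal `N_f`: the smallest symmetric ideal containing `f`. -/
noncomputable def symIdeal (f : L1) : Submodule ℝ L1 :=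
  sInf {X | IsSymmetricIdeal X ∧ f ∈ X}

/-- The principal majorant ideal `M_f`: the smallest majorant ideal containing `f`. -/
noncomputable def majIdeal (f : L1) : Submodule ℝ L1 :=
  sInf {X | IsMajorantIdeal X ∧ f ∈ X}

/-- The modular `n_f(x) = inf {s > 0 : x*(t) ≤ s f*(t / ŝ) for all t ∈ I}`, where
`ŝ = max (s, 1/s)`; the value is `∞` if there is no such `s`. -/
noncomputable def modular (f x : L1) : ℝ≥0∞ :=
  ⨅ (s : ℝ) (_ : 0 < s) (_ : ∀ t ∈ Ioc (0 : ℝ) 1, rearr x t ≤ s * rearr f (t / max s s⁻¹)),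
    ENNReal.ofReal s

/-- The modular topology of `N_f` is given by a norm: there is a norm `p` on `N_f` such that the
neighbourhoods of zero for `p` are the neighbourhoods of zero for the modular, i.e. the sets
containing some `{x : n_f(x) < ε}`, `ε > 0`. -/
def ModularNormable (f : L1) : Prop :=
  ∃ p : Seminorm ℝ (symIdeal f), (∀ x, p x = 0 → x = 0) ∧
    comap (fun x : symIdeal f => p x) (𝓝 (0 : ℝ)) =
      comap (fun x : symIdeal f => modular f (x : L1)) (𝓝 (0 : ℝ≥0∞))

/-- `σ`-subalgebras of the Lebesgue `σ`-algebra of `I`; they contain all null sets. (Since `lam`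
does not charge the complement of `I`, working with subsets of `ℝ` is harmless.) -/
structure IsSigmaSubalgebra (A : MeasurableSpace ℝ) : Prop where
  nullMeasurable : ∀ s, MeasurableSet[A] s → @NullMeasurableSet ℝ Real.measurableSpace s lam
  null_mem : ∀ s, lam s = 0 → MeasurableSet[A] s

/-- `y = E(x | A)`. -/
def IsCondExp (A : MeasurableSpace ℝ) (x y : L1) : Prop :=
  AEStronglyMeasurable[A] (y : ℝ → ℝ) lam ∧
    ∀ s, MeasurableSet[A] s → ∫ u in s, y u ∂lam = ∫ u in s, x u ∂lam

/-- `A` averages `X`: `E(X | A) ⊆ X`. -/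
def Averages (A : MeasurableSpace ℝ) (X : Submodule ℝ L1) : Prop :=
  ∀ x ∈ X, ∀ y : L1, IsCondExp A x y → y ∈ X

/-- The compression-dilation operator: `(ρ_s g)(t) = g(st)` if `0 < st ≤ 1` and `0` otherwise. -/
noncomputable def dil (s : ℝ) (g : ℝ → ℝ) : ℝ → ℝ :=
  indicator {t | 0 < s * t ∧ s * t ≤ 1} fun t => g (s * t)

/-- The Marcinkiewicz norm `sup_{t ∈ I} (∫₀ᵗ g* dλ) / ψ_f(t)`. The Marcinkiewicz space consists of
the functions in `L¹(I)` for which it is finite. -/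
noncomputable def marcNorm (f : L1) (g : ℝ → ℝ) : ℝ≥0∞ :=
  ⨆ t ∈ Ioc (0 : ℝ) 1, ENNReal.ofReal (psi g t / psi f t)

/-- The norm of `ρ_s` as an operator on the Marcinkiewicz space. -/
noncomputable def dilNorm (f : L1) (s : ℝ) : ℝ≥0∞ :=
  ⨆ (x : L1) (_ : marcNorm f x = 1), marcNorm f (dil s x)

end MeklerIdeals

namespace MeklerIdeals

/-! ### The decreasing rearrangement -/

/-! Condition 5 is the hub: every other condition is compared with it. By `mem_symIdeal_iff`, `x`
lies in N_f exactly when x*(t) ≤ s f*(t/s) for some s ≥ 1. Bounded perturbations are absorbed by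
enlarging s (`dominated_of_le_add`), so only the behaviour near zero matters. On the other side,
`psi_le_excess` and `psi_eq_excess` write ψ_x(t) as the minimum over c of ∫(|x| - c)₊ + tc, the
K-functional of (L¹, L^∞). This yields subadditivity of ψ, the Hardy–Littlewood inequality, and y* ≤
C x** whenever y is a conditional expectation of x or its image under an admissible operator.

If f** ≤ K f* near zero, N_f is therefore stable under passing from x to any y with y* ≤ C x**
(`RegularNearZero.dominated_of_le_maximalFn`). So N_f is averaged by every σ-subalgebra and is
majorant; since majorant ideals are symmetric (`IsMajorantIdeal.isSymmetricIdeal`), it equals M_f.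
If regularity fails, averaging f* over blocks (t_{n+1}, t_n] with t_n decreasing fast produces a
function of size at least f**(t_n)/2 on the n-th block, which is too large for N_f
(`exists_not_dominated_condExp`). This refutes conditions 2 and 3 at once.

Conditions 6 and 7 concern the growth of the concave function ψ, and both amount to `Halving`: ψ(st)
≤ ψ(t)/2 for one fixed s < 1. Iteration improves it to ψ(st) ≤ 2 s^r ψ(t), so that a small modular
forces a small Marcinkiewicz norm; regularity gives the reverse, and that norm defines the modular
topology. Conversely, suppose some norm does. All cyclic shifts of a step function lying under s
f*(s·) have small modular, so eight times their mean still has small norm and modular below 1. But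
the mean is constant on (0, t], of size about ψ(st)/t, and this forces halving
(`ModularNormable.halving`). -/

lemma lam_apply (s : Set ℝ) : lam s = volume (s ∩ Ioc (0 : ℝ) 1) :=
  Measure.restrict_apply' measurableSet_Ioc

instance : IsProbabilityMeasure lam := ⟨by simp⟩

lemma lam_Ioc {r : ℝ} (hr1 : r ≤ 1) : lam (Ioc 0 r) = ENNReal.ofReal r := by
  rw [lam_apply, inter_eq_left.2 (Ioc_subset_Ioc_right hr1), Real.volume_Ioc, sub_zero]

lemma rearr_nonneg (g : ℝ → ℝ) (t : ℝ) : 0 ≤ rearr g t :=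
  Real.sInf_nonneg fun _ hs => hs.1

lemma rearr_le_of_measure_le {g : ℝ → ℝ} {t s : ℝ} (hs : 0 ≤ s)
    (h : lam {u | s < |g u|} ≤ ENNReal.ofReal t) : rearr g t ≤ s :=
  csInf_le ⟨0, fun _ hs => hs.1⟩ ⟨hs, h⟩

/-- The sets {|g| > n} decrease to ∅ and λ is finite. For t ≤ 0 an essentially unbounded `g` leaves
the set empty and `sInf` takes the default value 0, which is why 0 < t recurs below. -/
lemma exists_measure_le {g : ℝ → ℝ} (hg : AEMeasurable g lam) {t : ℝ} (ht : 0 < t) :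
    {s : ℝ | 0 ≤ s ∧ lam {u | s < |g u|} ≤ ENNReal.ofReal t}.Nonempty := by
  have h : Tendsto (fun n : ℕ => lam {u | (n : ℝ) < |g u|}) atTop
      (𝓝 (lam (⋂ n : ℕ, {u | (n : ℝ) < |g u|}))) := by
    refine tendsto_measure_iInter_atTop (fun n => ?_) (fun m n hmn u hu => ?_)
      ⟨0, measure_ne_top _ _⟩
    · exact nullMeasurableSet_lt aemeasurable_const (measurable_norm.comp_aemeasurable hg)
    · exact lt_of_le_of_lt (Nat.cast_le.2 hmn) (show (n : ℝ) < _ from hu)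
  have h0 : (⋂ n : ℕ, {u | (n : ℝ) < |g u|}) = ∅ := by
    refine eq_empty_of_forall_notMem fun u hu => ?_
    obtain ⟨n, hn⟩ := exists_nat_ge |g u|
    exact absurd (mem_iInter.1 hu n) (not_lt.2 hn)
  rw [h0, measure_empty] at h
  obtain ⟨n, hn⟩ := (h.eventually (gt_mem_nhds (ENNReal.ofReal_pos.2 ht))).exists
  exact ⟨n, n.cast_nonneg, hn.le⟩

/-- The infimum defining g*(t) is attained, by continuity of λ along the increasing sets {|g| > s +
1/(n+1)}. Hence the Galois connection `rearr_le_iff` between g* and the distribution function, on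
which the calculus of rearrangements rests. -/
lemma measure_le_of_rearr_le {g : ℝ → ℝ} (hg : AEMeasurable g lam) {t s : ℝ} (ht : 0 < t)
    (h : rearr g t ≤ s) : lam {u | s < |g u|} ≤ ENNReal.ofReal t := by
  have hU : {u | s < |g u|} = ⋃ n : ℕ, {u | s + 1 / ((n : ℝ) + 1) < |g u|} := by
    ext u
    simp only [mem_ofPred_eq, mem_iUnion]
    constructor
    · intro hu
      obtain ⟨n, hn⟩ := exists_nat_one_div_lt (sub_pos.2 hu)
      exact ⟨n, by linarith⟩
    · rintro ⟨n, hn⟩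
      have : (0 : ℝ) < 1 / ((n : ℝ) + 1) := Nat.one_div_pos_of_nat
      linarith
  have hm : Monotone fun n : ℕ => {u | s + 1 / ((n : ℝ) + 1) < |g u|} := by
    intro m n hmn u hu
    have : 1 / ((n : ℝ) + 1) ≤ 1 / ((m : ℝ) + 1) := Nat.one_div_le_one_div hmn
    simp only [mem_ofPred_eq] at hu ⊢
    linarith
  rw [hU, hm.measure_iUnion]
  refine iSup_le fun n => ?_
  have hn : (0 : ℝ) < 1 / ((n : ℝ) + 1) := Nat.one_div_pos_of_nat
  obtain ⟨r, hr, hr'⟩ := exists_lt_of_csInf_lt (exists_measure_le hg ht)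
    (lt_of_le_of_lt h (lt_add_of_pos_right s hn))
  exact (measure_mono fun u (hu : _ < _) => hr'.trans hu).trans hr.2

lemma rearr_le_iff {g : ℝ → ℝ} (hg : AEMeasurable g lam) {t s : ℝ} (ht : 0 < t) (hs : 0 ≤ s) :
    rearr g t ≤ s ↔ lam {u | s < |g u|} ≤ ENNReal.ofReal t :=
  ⟨measure_le_of_rearr_le hg ht, rearr_le_of_measure_le hs⟩

lemma lt_rearr_iff {g : ℝ → ℝ} (hg : AEMeasurable g lam) {t s : ℝ} (ht : 0 < t) (hs : 0 ≤ s) :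
    s < rearr g t ↔ ENNReal.ofReal t < lam {u | s < |g u|} := by
  rw [← not_le, rearr_le_iff hg ht hs, not_le]

lemma measure_rearr_lt {g : ℝ → ℝ} (hg : AEMeasurable g lam) {t : ℝ} (ht : 0 < t) :
    lam {u | rearr g t < |g u|} ≤ ENNReal.ofReal t :=
  measure_le_of_rearr_le hg ht le_rfl

lemma rearr_antitone {g : ℝ → ℝ} (hg : AEMeasurable g lam) {a b : ℝ} (ha : 0 < a) (hab : a ≤ b) :
    rearr g b ≤ rearr g a :=
  rearr_le_of_measure_le (rearr_nonneg _ _)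
    ((measure_rearr_lt hg ha).trans (ENNReal.ofReal_le_ofReal hab))

lemma rearr_mono {g h : ℝ → ℝ} (hh : AEMeasurable h lam) (hgh : ∀ᵐ u ∂lam, |g u| ≤ |h u|)
    {t : ℝ} (ht : 0 < t) : rearr g t ≤ rearr h t := by
  refine rearr_le_of_measure_le (rearr_nonneg _ _) (le_trans ?_ (measure_rearr_lt hh ht))
  exact measure_mono_ae (hgh.mono fun u hu (h' : _ < _) => lt_of_lt_of_le h' hu)

lemma rearr_congr {g h : ℝ → ℝ} (hgh : g =ᵐ[lam] h) : rearr g = rearr h := by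
  funext t
  have : ∀ s : ℝ, lam {u | s < |g u|} = lam {u | s < |h u|} := fun s =>
    measure_congr (hgh.mono fun u hu => by
      change (s < |g u|) = (s < |h u|)
      rw [hu])
  simp only [rearr, this]

lemma rearr_le_of_ae_le {g : ℝ → ℝ} {M : ℝ} (hM : 0 ≤ M) (h : ∀ᵐ u ∂lam, |g u| ≤ M) (t : ℝ) :
    rearr g t ≤ M := by
  refine rearr_le_of_measure_le hM (le_of_eq_of_le ?_ zero_le)
  exact measure_mono_null (fun u (hu : M < |g u|) => not_le.2 hu) (ae_iff.1 h)

lemma rearr_eq_zero {g : ℝ → ℝ} {t : ℝ} (ht : 1 ≤ t) : rearr g t = 0 :=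
  le_antisymm (rearr_le_of_measure_le le_rfl
    (prob_le_one.trans (by simpa using ENNReal.ofReal_le_ofReal ht))) (rearr_nonneg _ _)

/-- Where |g + h| exceeds the sum of two levels, |g| or |h| exceeds its own level. -/
lemma rearr_add_le {g h : ℝ → ℝ} (hg : AEMeasurable g lam) (hh : AEMeasurable h lam) {a b : ℝ}
    (ha : 0 < a) (hb : 0 < b) : rearr (g + h) (a + b) ≤ rearr g a + rearr h b := by
  refine rearr_le_of_measure_le (add_nonneg (rearr_nonneg _ _) (rearr_nonneg _ _)) ?_
  rw [ENNReal.ofReal_add ha.le hb.le]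
  refine le_trans (le_trans (measure_mono ?_) (measure_union_le _ _))
    (add_le_add (measure_rearr_lt hg ha) (measure_rearr_lt hh hb))
  intro u hu
  simp only [mem_ofPred_eq, Pi.add_apply, mem_union] at hu ⊢
  by_contra! hc
  linarith [abs_add_le (g u) (h u)]

lemma rearr_le_rearr_add {g h : ℝ → ℝ} (hh : AEMeasurable h lam) {M : ℝ} (hM : 0 ≤ M)
    (hgh : ∀ᵐ u ∂lam, |g u| ≤ |h u| + M) {t : ℝ} (ht : 0 < t) : rearr g t ≤ rearr h t + M := by
  refine rearr_le_of_measure_le (add_nonneg (rearr_nonneg _ _) hM)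
    (le_trans ?_ (measure_rearr_lt hh ht))
  exact measure_mono_ae (hgh.mono fun u hu (h' : _ < _) => by
    change _ < _
    linarith)

lemma rearr_smul_le {g : ℝ → ℝ} (hg : AEMeasurable g lam) (c : ℝ) {t : ℝ} (ht : 0 < t) :
    rearr (c • g) t ≤ |c| * rearr g t := by
  refine rearr_le_of_measure_le (mul_nonneg (abs_nonneg _) (rearr_nonneg _ _))
    (le_trans (measure_mono fun u hu => ?_) (measure_rearr_lt hg ht))
  simp only [mem_ofPred_eq, Pi.smul_apply, smul_eq_mul, abs_mul] at hu ⊢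
  exact lt_of_mul_lt_mul_left hu (abs_nonneg _)

lemma rearr_smul {g : ℝ → ℝ} (hg : AEMeasurable g lam) (c : ℝ) {t : ℝ} (ht : 0 < t) :
    rearr (c • g) t = |c| * rearr g t := by
  refine le_antisymm (rearr_smul_le hg c ht) ?_
  rcases eq_or_ne c 0 with rfl | hc
  · simpa using rearr_nonneg _ _
  · have h := rearr_smul_le (hg.const_smul c) c⁻¹ ht
    rw [smul_smul, inv_mul_cancel₀ hc, one_smul, abs_inv] at h
    have := mul_le_mul_of_nonneg_left h (abs_nonneg c)
    rwa [← mul_assoc, mul_inv_cancel₀ (abs_ne_zero.2 hc), one_mul] at this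

/-- If `|g| ≥ c` on a set of measure at least `r`, then `g* ≥ c` on `(0, r)`. -/
lemma le_rearr_of_le_measure {g : ℝ → ℝ} (hg : AEMeasurable g lam) {c r t : ℝ} (ht : 0 < t)
    (htr : t < r) (h : ENNReal.ofReal r ≤ lam {u | c ≤ |g u|}) : c ≤ rearr g t := by
  by_contra! hc
  have h1 : lam {u | c ≤ |g u|} ≤ ENNReal.ofReal t :=
    (measure_mono fun u (hu : c ≤ _) => hc.trans_le hu).trans (measure_rearr_lt hg ht)
  exact absurd (h.trans h1) (not_le.2 ((ENNReal.ofReal_lt_ofReal_iff (ht.trans htr)).2 htr))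

lemma le_rearr_of_forall {g : ℝ → ℝ} (hg : AEMeasurable g lam) {c r t : ℝ} (ht : 0 < t)
    (htr : t < r) (hr : r ≤ 1) (h : ∀ᵐ u ∂lam, u ∈ Ioc 0 r → c ≤ |g u|) : c ≤ rearr g t :=
  le_rearr_of_le_measure hg ht htr ((lam_Ioc hr).symm.trans_le (measure_mono_ae h))

lemma ae_lam_mem : ∀ᵐ u ∂lam, u ∈ Ioc (0 : ℝ) 1 := ae_restrict_mem measurableSet_Ioc

/-- By `lt_rearr_iff`, {g* > s} meets (0,1] in the open interval from 0 whose length is the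
distribution function at s. -/
lemma measure_lt_rearr {g : ℝ → ℝ} (hg : AEMeasurable g lam) {s : ℝ} (hs : 0 ≤ s) :
    lam {t | s < rearr g t} = lam {u | s < |g u|} := by
  set m := lam {u | s < |g u|} with hm
  have hm1 : m ≤ 1 := prob_le_one
  have hmt : m ≠ ∞ := measure_ne_top _ _
  have : {t | s < rearr g t} ∩ Ioc (0 : ℝ) 1 = Ioo 0 m.toReal := by
    ext t
    simp only [mem_inter_iff, mem_ofPred_eq, mem_Ioc, mem_Ioo]
    constructor
    · rintro ⟨h, h0, -⟩
      exact ⟨h0, (ENNReal.ofReal_lt_iff_lt_toReal h0.le hmt).1 ((lt_rearr_iff hg h0 hs).1 h)⟩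
    · rintro ⟨h0, h⟩
      refine ⟨(lt_rearr_iff hg h0 hs).2 ((ENNReal.ofReal_lt_iff_lt_toReal h0.le hmt).2 h), h0, ?_⟩
      exact h.le.trans (ENNReal.toReal_mono ENNReal.one_ne_top hm1)
  rw [lam_apply, this, Real.volume_Ioo, sub_zero, ENNReal.ofReal_toReal hmt]

lemma aemeasurable_of_antitoneOn {h : ℝ → ℝ} (H : AntitoneOn h (Ioi 0)) (t : ℝ) :
    AEMeasurable h (volume.restrict (Ioc 0 t)) :=
  aemeasurable_restrict_of_antitoneOn measurableSet_Ioc (H.mono fun _ hu => hu.1)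

lemma rearr_antitoneOn {g : ℝ → ℝ} (hg : AEMeasurable g lam) : AntitoneOn (rearr g) (Ioi 0) :=
  fun _ ha _ _ hab => rearr_antitone hg ha hab

lemma aemeasurable_rearr {g : ℝ → ℝ} (hg : AEMeasurable g lam) : AEMeasurable (rearr g) lam :=
  aemeasurable_of_antitoneOn (rearr_antitoneOn hg) 1

lemma rearr_rearr {g : ℝ → ℝ} (hg : AEMeasurable g lam) : rearr (rearr g) = rearr g := by
  funext t
  rw [rearr, rearr]
  congr 1
  ext s
  simp only [mem_ofPred_eq, abs_of_nonneg (rearr_nonneg g _)]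
  constructor <;> rintro ⟨h0, h⟩ <;> refine ⟨h0, ?_⟩
  · rwa [measure_lt_rearr hg h0] at h
  · rwa [measure_lt_rearr hg h0]

/-- This transfers integrals of functions of |g| to g*. Half-lines determine the law, and for
negative s both events are everything. -/
lemma identDistrib_rearr {g : ℝ → ℝ} (hg : AEMeasurable g lam) :
    ProbabilityTheory.IdentDistrib (fun u => |g u|) (rearr g) lam lam := by
  have hm : AEMeasurable (fun u => |g u|) lam := measurable_norm.comp_aemeasurable hg
  have hm' := aemeasurable_rearr hg
  refine ⟨hm, hm', ?_⟩
  have := Measure.isProbabilityMeasure_map hm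
  have := Measure.isProbabilityMeasure_map hm'
  refine Measure.ext_of_Iic _ _ fun s => ?_
  rw [← compl_Ioi, prob_compl_eq_one_sub measurableSet_Ioi, prob_compl_eq_one_sub measurableSet_Ioi,
    Measure.map_apply_of_aemeasurable hm measurableSet_Ioi,
    Measure.map_apply_of_aemeasurable hm' measurableSet_Ioi]
  congr 1
  rcases le_or_gt 0 s with hs | hs
  · exact (measure_lt_rearr hg hs).symm
  · congr 1
    ext u
    simp only [mem_preimage, mem_Ioi]
    exact iff_of_true (hs.trans_le (abs_nonneg _)) (hs.trans_le (rearr_nonneg _ _))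

/-! ### The primitive of the rearrangement and the maximal function -/

lemma integrable_rearr {x : ℝ → ℝ} (hx : Integrable x lam) : Integrable (rearr x) lam :=
  (identDistrib_rearr hx.aemeasurable).integrable_iff.1 hx.abs

lemma integrableOn_rearr {x : ℝ → ℝ} (hx : Integrable x lam) {s : Set ℝ} (hs : s ⊆ Ioc 0 1) :
    IntegrableOn (rearr x) s :=
  IntegrableOn.mono_set (t := Ioc 0 1) (integrable_rearr hx) hs

lemma psi_nonneg (x : ℝ → ℝ) (t : ℝ) : 0 ≤ psi x t :=
  integral_nonneg fun _ => rearr_nonneg _ _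

lemma maximalFn_nonneg (x : ℝ → ℝ) {t : ℝ} (ht : 0 ≤ t) : 0 ≤ maximalFn x t :=
  mul_nonneg (inv_nonneg.2 ht) (psi_nonneg _ _)

lemma psi_congr {x y : ℝ → ℝ} (h : x =ᵐ[lam] y) : psi x = psi y := by
  funext t
  rw [psi, rearr_congr h, psi]

lemma psi_rearr {x : ℝ → ℝ} (hx : AEMeasurable x lam) : psi (rearr x) = psi x := by
  funext t
  rw [psi, rearr_rearr hx, psi]

lemma psi_zero (x : ℝ → ℝ) : psi x 0 = 0 := by simp [psi]

lemma psi_eq_intervalIntegral (x : ℝ → ℝ) {t : ℝ} (ht : 0 ≤ t) :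
    psi x t = ∫ u in (0 : ℝ)..t, rearr x u := by
  rw [psi, intervalIntegral.integral_of_le ht]

lemma psi_one {x : ℝ → ℝ} (hx : Integrable x lam) : psi x 1 = ∫ u, |x u| ∂lam :=
  (identDistrib_rearr hx.aemeasurable).integral_eq.symm

lemma psi_add_integral {x : ℝ → ℝ} (hx : Integrable x lam) {a b : ℝ} (ha : 0 ≤ a) (hab : a ≤ b)
    (hb : b ≤ 1) : psi x a + ∫ u in Ioc a b, rearr x u = psi x b := by
  rw [psi, psi, ← Ioc_union_Ioc_eq_Ioc ha hab]
  exact (setIntegral_union (Ioc_disjoint_Ioc_of_le le_rfl) measurableSet_Ioc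
    (integrableOn_rearr hx (Ioc_subset_Ioc_right (hab.trans hb)))
    (integrableOn_rearr hx (Ioc_subset_Ioc ha hb))).symm

lemma psi_mono {x : ℝ → ℝ} (hx : Integrable x lam) {a b : ℝ} (ha : 0 ≤ a) (hab : a ≤ b)
    (hb : b ≤ 1) : psi x a ≤ psi x b := by
  rw [← psi_add_integral hx ha hab hb]
  exact le_add_of_nonneg_right (integral_nonneg fun _ => rearr_nonneg _ _)

/-- With `psi_add_le_psi` this is the concavity of ψ: the slope over [a, b] lies between x*(b) and
x*(a). -/
lemma psi_le_psi_add {x : ℝ → ℝ} (hx : Integrable x lam) {a b : ℝ} (ha : 0 < a) (hab : a ≤ b)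
    (hb : b ≤ 1) : psi x b ≤ psi x a + (b - a) * rearr x a := by
  rw [← psi_add_integral hx ha.le hab hb]
  gcongr
  calc ∫ u in Ioc a b, rearr x u ≤ ∫ u in Ioc a b, rearr x a :=
        setIntegral_mono_on (integrableOn_rearr hx (Ioc_subset_Ioc ha.le hb)) (by simp)
          measurableSet_Ioc fun u hu => rearr_antitone hx.aemeasurable ha hu.1.le
    _ = (b - a) * rearr x a := by simp [hab]

lemma psi_add_le_psi {x : ℝ → ℝ} (hx : Integrable x lam) {a b : ℝ} (ha : 0 ≤ a) (hab : a ≤ b)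
    (hb : b ≤ 1) : psi x a + (b - a) * rearr x b ≤ psi x b := by
  rw [← psi_add_integral hx ha hab hb]
  gcongr
  calc (b - a) * rearr x b = ∫ u in Ioc a b, rearr x b := by simp [hab]
    _ ≤ ∫ u in Ioc a b, rearr x u :=
        setIntegral_mono_on (by simp) (integrableOn_rearr hx (Ioc_subset_Ioc ha hb))
          measurableSet_Ioc fun u hu => rearr_antitone hx.aemeasurable (ha.trans_lt hu.1) hu.2

lemma mul_rearr_le_psi {x : ℝ → ℝ} (hx : Integrable x lam) {t : ℝ} (ht : 0 ≤ t) (ht1 : t ≤ 1) :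
    t * rearr x t ≤ psi x t := by
  simpa [psi_zero] using psi_add_le_psi hx le_rfl ht ht1

lemma rearr_le_maximalFn {x : ℝ → ℝ} (hx : Integrable x lam) {t : ℝ} (ht : 0 < t) (ht1 : t ≤ 1) :
    rearr x t ≤ maximalFn x t := by
  rw [maximalFn, le_inv_mul_iff₀ ht]
  exact mul_rearr_le_psi hx ht.le ht1

lemma mul_maximalFn (x : ℝ → ℝ) {t : ℝ} (ht : 0 < t) : t * maximalFn x t = psi x t := by
  rw [maximalFn, mul_inv_cancel_left₀ ht.ne']

lemma maximalFn_antitoneOn {x : ℝ → ℝ} (hx : Integrable x lam) :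
    AntitoneOn (maximalFn x) (Ioc 0 1) := by
  intro a ha b hb hab
  have h1 := psi_le_psi_add hx ha.1 hab hb.2
  have h2 := rearr_le_maximalFn hx ha.1 ha.2
  have h3 := mul_le_mul_of_nonneg_left h2 (sub_nonneg.2 hab)
  rw [maximalFn, inv_mul_le_iff₀ hb.1]
  rw [← mul_maximalFn x ha.1] at h1
  linarith

lemma exists_psi_le {x : ℝ → ℝ} (hx : Integrable x lam) {ε : ℝ} (hε : 0 < ε) :
    ∃ δ ∈ Ioo (0 : ℝ) 1, ∀ t ∈ Icc 0 δ, psi x t ≤ ε := by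
  have hi : IntervalIntegrable (rearr x) volume 0 1 :=
    (intervalIntegrable_iff_integrableOn_Ioc_of_le zero_le_one).2 (integrable_rearr hx)
  have hc : ContinuousOn (fun t => ∫ u in (0 : ℝ)..t, rearr x u) (uIcc 0 1) :=
    intervalIntegral.continuousOn_primitive_interval' hi (by simp)
  have h0 := (hc 0 (by simp)).tendsto
  rw [intervalIntegral.integral_same] at h0
  have h1 : Tendsto (fun t => ∫ u in (0 : ℝ)..t, rearr x u) (𝓝[>] 0) (𝓝 0) := by
    refine h0.mono_left ?_
    rw [uIcc_of_le zero_le_one, ← nhdsWithin_Ioo_eq_nhdsGT (zero_lt_one' ℝ)]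
    exact nhdsWithin_mono _ Ioo_subset_Icc_self
  have h2 := (h1.eventually (gt_mem_nhds hε)).and (Ioo_mem_nhdsGT (zero_lt_one' ℝ))
  obtain ⟨δ, hδ, hδ'⟩ := h2.exists
  rw [← psi_eq_intervalIntegral x hδ'.1.le] at hδ
  exact ⟨δ, hδ', fun t ht => (psi_mono hx ht.1 ht.2 hδ'.2.le).trans hδ.le⟩

/-- The excess of `|x|` over the level `c` controls `ψ_x`. -/
lemma psi_le_excess {x : ℝ → ℝ} (hx : Integrable x lam) {c t : ℝ} (ht : 0 ≤ t)
    (ht1 : t ≤ 1) : psi x t ≤ (∫ u, max (|x u| - c) 0 ∂lam) + t * c := by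
  have hm : Measurable fun v : ℝ => max (v - c) 0 := by fun_prop
  have he : ∫ u, max (|x u| - c) 0 ∂lam = ∫ u, max (rearr x u - c) 0 ∂lam :=
    ((identDistrib_rearr hx.aemeasurable).comp hm).integral_eq
  have hi : Integrable (fun u => max (rearr x u - c) 0) lam :=
    ((integrable_rearr hx).sub (integrable_const c)).pos_part
  have hsub : Ioc (0 : ℝ) t ⊆ Ioc 0 1 := Ioc_subset_Ioc_right ht1
  have hi' : IntegrableOn (fun u => max (rearr x u - c) 0) (Ioc 0 t) :=
    IntegrableOn.mono_set (t := Ioc 0 1) hi hsub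
  rw [he]
  calc psi x t ≤ ∫ u in Ioc 0 t, (max (rearr x u - c) 0 + c) :=
        setIntegral_mono (integrableOn_rearr hx hsub) (hi'.add (by simp))
          fun u => by linarith [le_max_left (rearr x u - c) 0]
    _ = (∫ u in Ioc 0 t, max (rearr x u - c) 0) + t * c := by
        rw [integral_add hi' (by simp)]
        simp [ht]
    _ ≤ _ := add_le_add (setIntegral_mono_set hi (ae_of_all _ fun u => le_max_right _ _)
          hsub.eventuallyLE) le_rfl

/-- The level c = x*(t) is optimal in `psi_le_excess`: x* ≥ c on (0, t] and x* ≤ c beyond t, so the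
positive part is x* - c on (0, t] and 0 elsewhere. -/
lemma psi_eq_excess {x : ℝ → ℝ} (hx : Integrable x lam) {t : ℝ} (ht : 0 < t)
    (ht1 : t ≤ 1) :
    psi x t = (∫ u, max (|x u| - rearr x t) 0 ∂lam) + t * rearr x t := by
  set c := rearr x t with hc
  have hm : Measurable fun v : ℝ => max (v - c) 0 := by fun_prop
  have he : ∫ u, max (|x u| - c) 0 ∂lam = ∫ u, max (rearr x u - c) 0 ∂lam :=
    ((identDistrib_rearr hx.aemeasurable).comp hm).integral_eq
  have hsub : Ioc (0 : ℝ) t ⊆ Ioc 0 1 := Ioc_subset_Ioc_right ht1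
  have h1 : ∫ u, max (rearr x u - c) 0 ∂lam = ∫ u in Ioc 0 t, max (rearr x u - c) 0 :=
    setIntegral_eq_of_subset_of_forall_sdiff_eq_zero measurableSet_Ioc hsub fun u hu => by
      have : t < u := not_le.1 fun h => hu.2 ⟨hu.1.1, h⟩
      exact max_eq_right (sub_nonpos.2 (rearr_antitone hx.aemeasurable ht this.le))
  have h2 : ∫ u in Ioc 0 t, max (rearr x u - c) 0 = ∫ u in Ioc 0 t, (rearr x u - c) :=
    setIntegral_congr_fun measurableSet_Ioc fun u hu =>
      max_eq_left (sub_nonneg.2 (rearr_antitone hx.aemeasurable hu.1 hu.2))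
  rw [he, h1, h2, integral_sub (integrableOn_rearr hx hsub) (by simp), ← psi]
  simp [ht.le]

/-- Test `x + y` in the excess bound at the level x*(t) + y*(t); the excesses add up because (a +
b)₊ ≤ a₊ + b₊. -/
lemma psi_add_le {x y : ℝ → ℝ} (hx : Integrable x lam) (hy : Integrable y lam) {t : ℝ}
    (ht : 0 < t) (ht1 : t ≤ 1) : psi (x + y) t ≤ psi x t + psi y t := by
  have h := psi_le_excess (hx.add hy) (c := rearr x t + rearr y t) ht.le ht1
  have hi : ∀ {z : ℝ → ℝ} (_ : Integrable z lam) (c : ℝ),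
      Integrable (fun u => max (|z u| - c) 0) lam :=
    fun hz c => (hz.abs.sub (integrable_const c)).pos_part
  have h2 : ∫ u, max (|(x + y) u| - (rearr x t + rearr y t)) 0 ∂lam ≤
      (∫ u, max (|x u| - rearr x t) 0 ∂lam) + ∫ u, max (|y u| - rearr y t) 0 ∂lam := by
    rw [← integral_add (hi hx _) (hi hy _)]
    refine integral_mono (hi (hx.add hy) _) ((hi hx _).add (hi hy _)) fun u => ?_
    have h1 := le_max_left (|x u| - rearr x t) 0
    have h2 := le_max_left (|y u| - rearr y t) 0
    have h3 := le_max_right (|x u| - rearr x t) 0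
    have h4 := le_max_right (|y u| - rearr y t) 0
    have h5 := abs_add_le (x u) (y u)
    exact max_le (by simp only [Pi.add_apply]; linarith) (by positivity)
  rw [psi_eq_excess hx ht ht1, psi_eq_excess hy ht ht1]
  linarith

/-- The Hardy–Littlewood inequality for characteristic functions. -/
lemma setIntegral_abs_le_psi {x : ℝ → ℝ} (hx : Integrable x lam) (E : Set ℝ) :
    ∫ u in E, |x u| ∂lam ≤ psi x (lam E).toReal := by
  set t := (lam E).toReal with ht
  have ht0 : 0 ≤ t := ENNReal.toReal_nonneg
  have ht1 : t ≤ 1 := ENNReal.toReal_mono ENNReal.one_ne_top prob_le_one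
  rcases ht0.eq_or_lt with h0 | h0
  · have : lam E = 0 := ((ENNReal.toReal_eq_zero_iff _).1 h0.symm).resolve_right (measure_ne_top _ _)
    rw [Measure.restrict_eq_zero.2 this]
    simpa using psi_nonneg _ _
  rw [psi_eq_excess hx h0 ht1]
  set c := rearr x t
  have hi : Integrable (fun u => max (|x u| - c) 0) lam :=
    (hx.abs.sub (integrable_const c)).pos_part
  calc ∫ u in E, |x u| ∂lam ≤ ∫ u in E, (max (|x u| - c) 0 + c) ∂lam :=
        setIntegral_mono hx.abs.integrableOn
          (hi.integrableOn.add (integrable_const c).integrableOn)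
          fun u => by linarith [le_max_left (|x u| - c) 0]
    _ = (∫ u in E, max (|x u| - c) 0 ∂lam) + t * c := by
        rw [integral_add hi.integrableOn (integrable_const c).integrableOn]
        simp [measureReal_def, ht]
    _ ≤ _ := add_le_add
        (setIntegral_le_integral hi (ae_of_all _ fun u => le_max_right _ _)) le_rfl

lemma integral_rearr_mul (x : ℝ → ℝ) {s t : ℝ} (hs : 0 < s) (ht : 0 ≤ t) :
    ∫ u in Ioc 0 t, rearr x (s * u) = s⁻¹ * psi x (s * t) := by
  rw [← intervalIntegral.integral_of_le ht, intervalIntegral.integral_comp_mul_left _ hs.ne',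
    mul_zero, psi_eq_intervalIntegral x (mul_nonneg hs.le ht), smul_eq_mul]

lemma integrableOn_rearr_mul {x : ℝ → ℝ} (hx : Integrable x lam) {s t : ℝ} (hs : 0 < s)
    (ht : 0 ≤ t) (hst : s * t ≤ 1) : IntegrableOn (fun u => rearr x (s * u)) (Ioc 0 t) := by
  rw [← intervalIntegrable_iff_integrableOn_Ioc_of_le ht]
  have : IntervalIntegrable (rearr x) volume 0 (s * t) :=
    (intervalIntegrable_iff_integrableOn_Ioc_of_le (mul_nonneg hs.le ht)).2
      (integrableOn_rearr hx (Ioc_subset_Ioc_right hst))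
  simpa [hs.ne'] using this.comp_mul_left (c := s)

lemma rearr_le_psi_one_div {x : ℝ → ℝ} (hx : Integrable x lam) {t : ℝ} (ht : 0 < t)
    (ht1 : t ≤ 1) : rearr x t ≤ (∫ u, |x u| ∂lam) / t := by
  rw [le_div_iff₀ ht, mul_comm, ← psi_one hx]
  exact (mul_rearr_le_psi hx ht.le ht1).trans (psi_mono hx ht.le ht1 le_rfl)

lemma psi_pos {f : L1} (hf : f ≠ 0) {t : ℝ} (ht : 0 < t) (ht1 : t ≤ 1) : 0 < psi f t := by
  by_contra! h
  have hi := L1.integrable_coeFn f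
  have h0 : rearr f t = 0 := le_antisymm
    (nonpos_of_mul_nonpos_right ((mul_rearr_le_psi hi ht.le ht1).trans h) ht) (rearr_nonneg _ _)
  have h1 := psi_le_psi_add hi ht ht1 le_rfl
  rw [h0, mul_zero, add_zero, psi_one hi] at h1
  have h2 : ∫ u, |f u| ∂lam = 0 :=
    le_antisymm (h1.trans h) (integral_nonneg fun u => abs_nonneg _)
  refine hf ((Lp.eq_zero_iff_ae_eq_zero).2 ?_)
  filter_upwards [(integral_eq_zero_iff_of_nonneg (fun u => abs_nonneg _) hi.abs).1 h2] with u hu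
  exact abs_eq_zero.1 hu

lemma exists_rearr_pos {f : L1} (hf : f ≠ 0) :
    ∃ δ ∈ Ioo (0 : ℝ) 1, 0 < rearr f δ := by
  by_contra! h
  have hi := L1.integrable_coeFn f
  have h1 : psi f 1 = 0 := by
    rw [psi]
    refine (setIntegral_congr_ae (g := fun _ => (0 : ℝ)) measurableSet_Ioc ?_).trans (by simp)
    refine ae_of_all _ fun u hu => le_antisymm ?_ (rearr_nonneg _ _)
    exact (rearr_antitone hi.aemeasurable (half_pos hu.1) (by linarith [hu.1])).trans
      (h _ ⟨half_pos hu.1, by linarith [hu.2]⟩)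
  exact (psi_pos hf one_pos le_rfl).ne' h1

/-! ### The principal symmetric ideal -/

lemma aemeasurable_coe (x : L1) : AEMeasurable x lam := (L1.integrable_coeFn x).aemeasurable

lemma abs_le_abs_iff_ae (x y : L1) : |y| ≤ |x| ↔ ∀ᵐ u ∂lam, |y u| ≤ |x u| := by
  rw [← Lp.coeFn_le]
  constructor <;> intro h <;> filter_upwards [h, Lp.coeFn_abs x, Lp.coeFn_abs y] with u h1 h2 h3
  · rwa [h2, h3] at h1
  · rwa [h2, h3]

lemma exists_bound_of_memLp {x : ℝ → ℝ} (hx : MemLp x ∞ lam) :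
    ∃ M, 0 ≤ M ∧ ∀ᵐ u ∂lam, |x u| ≤ M := by
  refine ⟨(eLpNorm x ∞ lam).toReal, ENNReal.toReal_nonneg, ?_⟩
  have h := ae_le_eLpNormEssSup (f := x) (μ := lam)
  filter_upwards [h] with u hu
  rw [← eLpNorm_exponent_top] at hu
  have := ENNReal.toReal_mono hx.2.ne hu
  simpa using this

lemma memLp_top_of_bound_ae {x : L1} {M : ℝ} (h : ∀ᵐ u ∂lam, |x u| ≤ M) : MemLp x ∞ lam :=
  memLp_top_of_bound (Lp.aestronglyMeasurable x) M h

/-- Right-continuity of g*. The extra length v - t supplies the strict inequality of measures that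
`lt_rearr_iff` demands. -/
lemma exists_gt_lt_rearr {g : ℝ → ℝ} (hg : AEMeasurable g lam) {s t r : ℝ} (hs : 0 ≤ s)
    (ht : 0 < t) (htr : t < r) (h : s < rearr g t) : ∃ v ∈ Ioc t r, s < rearr g v := by
  have hm : lam {u | s < |g u|} ≠ ∞ := measure_ne_top _ _
  have h1 := (ENNReal.ofReal_lt_iff_lt_toReal ht.le hm).1 ((lt_rearr_iff hg ht hs).1 h)
  obtain ⟨v, hv, hv'⟩ := exists_between (lt_min h1 htr)
  have hv0 := ht.trans hv
  refine ⟨v, ⟨hv, hv'.le.trans (min_le_right _ _)⟩, (lt_rearr_iff hg hv0 hs).2 ?_⟩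
  exact (ENNReal.ofReal_lt_iff_lt_toReal hv0.le hm).2 (hv'.trans_le (min_le_left _ _))

/-- The functions `x` with `x*(t) ≤ s f*(t / s)` for some `s ≥ 1`. -/
def Dominated (f x : L1) : Prop :=
  ∃ s, 1 ≤ s ∧ ∀ t ∈ Ioc (0 : ℝ) 1, rearr x t ≤ s * rearr f (t / s)

lemma mul_rearr_div_mono (f : L1) {a b c d t : ℝ} (ha : 0 ≤ a) (hab : a ≤ b) (hc : 0 < c)
    (hcd : c ≤ d) (ht : 0 < t) : a * rearr f (t / c) ≤ b * rearr f (t / d) :=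
  mul_le_mul hab (rearr_antitone (aemeasurable_coe f) (div_pos ht (hc.trans_le hcd))
    (div_le_div_of_nonneg_left ht.le hc hcd)) (rearr_nonneg _ _) (ha.trans hab)

lemma Dominated.add {f x y : L1} (hx : Dominated f x) (hy : Dominated f y) :
    Dominated f (x + y) := by
  obtain ⟨a, ha, hx⟩ := hx
  obtain ⟨b, hb, hy⟩ := hy
  -- The sum a + b serves both dilations, and the factor 2 pays for splitting t into two halves.
  refine ⟨2 * (a + b), by linarith, fun t ht => ?_⟩
  have h2 : 0 < t / 2 := half_pos ht.1
  have h3 : t / 2 ∈ Ioc (0 : ℝ) 1 := ⟨h2, by linarith [ht.2, ht.1]⟩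
  rw [rearr_congr (Lp.coeFn_add x y)]
  calc rearr (⇑x + ⇑y) t = rearr (⇑x + ⇑y) (t / 2 + t / 2) := by rw [add_halves]
    _ ≤ rearr x (t / 2) + rearr y (t / 2) :=
        rearr_add_le (aemeasurable_coe x) (aemeasurable_coe y) h2 h2
    _ ≤ a * rearr f (t / 2 / a) + b * rearr f (t / 2 / b) := add_le_add (hx _ h3) (hy _ h3)
    _ ≤ a * rearr f (t / 2 / (a + b)) + b * rearr f (t / 2 / (a + b)) :=
        add_le_add (mul_rearr_div_mono f (by linarith) le_rfl (by linarith) (by linarith) h2)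
          (mul_rearr_div_mono f (by linarith) le_rfl (by linarith) (by linarith) h2)
    _ = (a + b) * rearr f (t / (2 * (a + b))) := by rw [← add_mul, div_div]
    _ ≤ 2 * (a + b) * rearr f (t / (2 * (a + b))) :=
        mul_le_mul_of_nonneg_right (by linarith) (rearr_nonneg _ _)

lemma Dominated.smul {f x : L1} (hx : Dominated f x) (c : ℝ) : Dominated f (c • x) := by
  obtain ⟨a, ha, hx⟩ := hx
  have h1 : 1 ≤ max 1 |c| := le_max_left _ _
  have h2 : a ≤ max 1 |c| * a := le_mul_of_one_le_left (by linarith) h1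
  refine ⟨max 1 |c| * a, by linarith, fun t ht => ?_⟩
  rw [rearr_congr (Lp.coeFn_smul c x)]
  calc rearr (c • ⇑x) t ≤ |c| * rearr x t := rearr_smul_le (aemeasurable_coe x) c ht.1
    _ ≤ max 1 |c| * (a * rearr f (t / a)) :=
        mul_le_mul (le_max_right _ _) (hx t ht) (rearr_nonneg _ _) (by linarith)
    _ = (max 1 |c| * a) * rearr f (t / a) := (mul_assoc _ _ _).symm
    _ ≤ _ := mul_rearr_div_mono f (by linarith) le_rfl (by linarith) h2 ht.1

/-- The functions dominated by `f` up to dilation form a vector space. -/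
def dominatedSubmodule (f : L1) : Submodule ℝ L1 where
  carrier := {x | Dominated f x}
  add_mem' := fun hx hy => Dominated.add hx hy
  zero_mem' := by
    refine ⟨1, le_rfl, fun t _ => ?_⟩
    rw [rearr_congr (Lp.coeFn_zero ℝ 1 lam), one_mul]
    exact (rearr_le_of_ae_le le_rfl (by simp) t).trans (rearr_nonneg _ _)
  smul_mem' := fun c _ hx => Dominated.smul hx c

/-- Enlarging the dilation until t/S ≤ δ for all t ≤ 1 keeps f*(t/S) ≥ f*(δ) > 0, so the constant M
becomes a multiple of f*(t/S). -/
lemma dominated_of_le_add {f : L1} (hf : f ≠ 0) {x : L1} {K M s : ℝ} (hK : 0 ≤ K) (hM : 0 ≤ M)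
    (hs : 1 ≤ s) (h : ∀ t ∈ Ioc (0 : ℝ) 1, rearr x t ≤ K * rearr f (t / s) + M) :
    Dominated f x := by
  obtain ⟨δ, hδ, hδ'⟩ := exists_rearr_pos hf
  have h1 : 0 < δ⁻¹ := inv_pos.2 hδ.1
  have h3 : 0 ≤ M / rearr f δ := div_nonneg hM hδ'.le
  set S := K + M / rearr f δ + s + δ⁻¹ with hS
  refine ⟨S, by linarith, fun t ht => (h t ht).trans ?_⟩
  have h4 : t / S ≤ δ := by
    rw [div_le_iff₀ (by linarith)]
    calc t ≤ 1 := ht.2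
      _ = δ * δ⁻¹ := (mul_inv_cancel₀ hδ.1.ne').symm
      _ ≤ _ := mul_le_mul_of_nonneg_left (by linarith) hδ.1.le
  have h5 : M ≤ M / rearr f δ * rearr f (t / S) := by
    calc M = M / rearr f δ * rearr f δ := (div_mul_cancel₀ _ hδ'.ne').symm
      _ ≤ _ := mul_le_mul_of_nonneg_left
        (rearr_antitone (aemeasurable_coe f) (div_pos ht.1 (by linarith)) h4) h3
  have h6 : K * rearr f (t / s) ≤ K * rearr f (t / S) :=
    mul_rearr_div_mono f hK le_rfl (by linarith) (by linarith) ht.1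
  calc K * rearr f (t / s) + M ≤ (K + M / rearr f δ) * rearr f (t / S) := by
        rw [add_mul]
        linarith
    _ ≤ S * rearr f (t / S) := mul_le_mul_of_nonneg_right (by linarith) (rearr_nonneg _ _)

lemma dominated_of_bound {f : L1} (hf : f ≠ 0) {x : L1} {M : ℝ} (hM : 0 ≤ M)
    (h : ∀ t ∈ Ioc (0 : ℝ) 1, rearr x t ≤ M) : Dominated f x :=
  dominated_of_le_add hf le_rfl hM le_rfl fun t ht => by simpa using h t ht

lemma isSymmetricIdeal_dominatedSubmodule {f : L1} (hf : f ≠ 0) :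
    IsSymmetricIdeal (dominatedSubmodule f) where
  bounded_mem x hx := by
    obtain ⟨M, hM, h⟩ := exists_bound_of_memLp hx
    exact dominated_of_bound hf hM fun t _ => rearr_le_of_ae_le hM h t
  solid x hx y hy := by
    obtain ⟨s, hs, hx⟩ := hx
    exact ⟨s, hs, fun t ht => (rearr_mono (aemeasurable_coe x)
      ((abs_le_abs_iff_ae x y).1 hy) ht.1).trans (hx t ht)⟩
  symm x hx y hy := by
    obtain ⟨s, hs, hx⟩ := hx
    exact ⟨s, hs, fun t ht => (hy t ht).trans (hx t ht)⟩

/-- The rearrangement as an element of `L¹`. -/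
noncomputable def rearrL (x : L1) : L1 := (integrable_rearr (L1.integrable_coeFn x)).toL1 _

lemma coeFn_rearrL (x : L1) : rearrL x =ᵐ[lam] rearr x := Integrable.coeFn_toL1 _

lemma rearr_rearrL (x : L1) : rearr (rearrL x) = rearr x := by
  rw [rearr_congr (coeFn_rearrL x), rearr_rearr (aemeasurable_coe x)]

/-- Place two copies of x* restricted to (0, 1/2] side by side in (0, 1]. Each has its rearrangement
below x*, so lies in `X`, while their sum has each level set above height s doubled up to total
length 1. At t = 1 the rearrangement of the sum vanishes, hence the open interval. -/
lemma IsSymmetricIdeal.exists_double {X : Submodule ℝ L1} (hX : IsSymmetricIdeal X) {x : L1}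
    (hx : x ∈ X) : ∃ z ∈ X, ∀ t ∈ Ioo (0 : ℝ) 1, rearr x (t / 2) ≤ rearr z t := by
  have hxm := aemeasurable_coe x
  have hxi := L1.integrable_coeFn x
  have hi := integrable_rearr hxi
  set g₁ : ℝ → ℝ := indicator (Ioc 0 (1 / 2)) (rearr x) with hg₁
  set g₂ : ℝ → ℝ := indicator (Ioc (1 / 2) 1) (fun u => rearr x (u - 1 / 2)) with hg₂
  have hi₁ : Integrable g₁ lam := hi.indicator measurableSet_Ioc
  have hi₂ : Integrable g₂ lam := by
    rw [hg₂, integrable_indicator_iff measurableSet_Ioc, IntegrableOn,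
      Measure.restrict_restrict measurableSet_Ioc, inter_eq_left.2 (Ioc_subset_Ioc_left (by norm_num))]
    change IntegrableOn _ _ _
    rw [← intervalIntegrable_iff_integrableOn_Ioc_of_le (by norm_num)]
    have : IntervalIntegrable (rearr x) volume 0 (1 / 2) :=
      (intervalIntegrable_iff_integrableOn_Ioc_of_le (by norm_num)).2
        (integrableOn_rearr hxi (Ioc_subset_Ioc_right (by norm_num)))
    have := this.comp_sub_right (1 / 2)
    norm_num at this
    exact this
  have h₁ : ∀ t, 0 < t → rearr g₁ t ≤ rearr x t := fun t ht => by
    rw [← rearr_rearr hxm]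
    refine rearr_mono (aemeasurable_rearr hxm) (ae_of_all _ fun u => ?_) ht
    exact norm_indicator_le_norm_self (rearr x) u
  have h₂ : ∀ t, 0 < t → rearr g₂ t ≤ rearr x t := fun t ht => by
    refine rearr_le_of_measure_le (rearr_nonneg _ _) (le_trans ?_ (measure_rearr_lt hxm ht))
    rw [← measure_lt_rearr hxm (rearr_nonneg _ _), lam_apply, lam_apply]
    rw [← measure_preimage_add_right volume (-(1 / 2)) ({u | rearr x t < rearr x u} ∩ Ioc 0 1)]
    refine measure_mono fun u hu => ?_
    have hu' : u ∈ Ioc (1 / 2 : ℝ) 1 := by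
      by_contra h
      have := hu.1
      simp only [hg₂, mem_ofPred_eq, indicator_of_notMem h, abs_zero] at this
      exact absurd this (not_lt.2 (rearr_nonneg _ _))
    have := hu.1
    simp only [hg₂, mem_ofPred_eq, indicator_of_mem hu', abs_of_nonneg (rearr_nonneg _ _)] at this
    exact ⟨this, by simpa using hu'.1, by linarith [hu'.2]⟩
  refine ⟨hi₁.toL1 g₁ + hi₂.toL1 g₂, X.add_mem (hX.symm x hx _ fun t ht => ?_)
    (hX.symm x hx _ fun t ht => ?_), fun t ht => ?_⟩
  · rw [rearr_congr hi₁.coeFn_toL1]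
    exact h₁ t ht.1
  · rw [rearr_congr hi₂.coeFn_toL1]
    exact h₂ t ht.1
  · rw [rearr_congr ((Lp.coeFn_add _ _).trans (hi₁.coeFn_toL1.add hi₂.coeFn_toL1))]
    refine le_of_forall_lt_imp_le_of_dense fun s hs => ?_
    rcases lt_or_ge s 0 with hs0 | hs0
    · exact hs0.le.trans (rearr_nonneg _ _)
    obtain ⟨v, hv, hsv⟩ := exists_gt_lt_rearr hxm hs0 (half_pos ht.1)
      (show t / 2 < 1 / 2 by linarith [ht.2]) hs
    have hv0 : 0 < v := (half_pos ht.1).trans hv.1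
    refine ((lt_rearr_iff (hi₁.add hi₂).aemeasurable ht.1 hs0).2 ?_).le
    have hsub : Ioc 0 v ∪ Ioc (1 / 2) (1 / 2 + v) ⊆ {u | s < |(g₁ + g₂) u|} ∩ Ioc 0 1 := by
      rintro u (hu | hu)
      · have h1 : u ∈ Ioc (0 : ℝ) (1 / 2) := ⟨hu.1, hu.2.trans hv.2⟩
        have h2 : u ∉ Ioc (1 / 2 : ℝ) 1 := fun h => absurd h.1 (not_lt.2 h1.2)
        refine ⟨?_, h1.1, by linarith [h1.2]⟩
        simp only [mem_ofPred_eq, Pi.add_apply, hg₁, hg₂, indicator_of_mem h1,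
          indicator_of_notMem h2, add_zero, abs_of_nonneg (rearr_nonneg _ _)]
        exact hsv.trans_le (rearr_antitone hxm hu.1 hu.2)
      · have h2 : u ∈ Ioc (1 / 2 : ℝ) 1 := ⟨hu.1, by linarith [hu.2, hv.2]⟩
        have h1 : u ∉ Ioc (0 : ℝ) (1 / 2) := fun h => absurd h.2 (not_le.2 h2.1)
        refine ⟨?_, by linarith [h2.1], h2.2⟩
        simp only [mem_ofPred_eq, Pi.add_apply, hg₁, hg₂, indicator_of_notMem h1,
          indicator_of_mem h2, zero_add, abs_of_nonneg (rearr_nonneg _ _)]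
        exact hsv.trans_le (rearr_antitone hxm (by linarith [hu.1]) (by linarith [hu.2]))
    rw [lam_apply]
    refine lt_of_lt_of_le ?_ (measure_mono hsub)
    rw [measure_union (Ioc_disjoint_Ioc_of_le hv.2) measurableSet_Ioc, Real.volume_Ioc,
      Real.volume_Ioc, ← ENNReal.ofReal_add (by linarith) (by linarith)]
    exact (ENNReal.ofReal_lt_ofReal_iff (by linarith)).2 (by linarith [hv.1])

lemma IsSymmetricIdeal.exists_dilation {X : Submodule ℝ L1} (hX : IsSymmetricIdeal X) {x : L1}
    (hx : x ∈ X) (k : ℕ) : ∃ z ∈ X, ∀ t ∈ Ioo (0 : ℝ) 1, rearr x (t / 2 ^ k) ≤ rearr z t := by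
  induction k with
  | zero => exact ⟨x, hx, by simp⟩
  | succ k ih =>
    obtain ⟨z, hz, h⟩ := ih
    obtain ⟨w, hw, h'⟩ := hX.exists_double hz
    refine ⟨w, hw, fun t ht => ?_⟩
    rw [pow_succ', ← div_div]
    exact (h (t / 2) ⟨half_pos ht.1, by linarith [ht.2, ht.1]⟩).trans (h' t ht)

lemma IsSymmetricIdeal.mem_of_dominated {X : Submodule ℝ L1} (hX : IsSymmetricIdeal X) {f y : L1}
    (hf : f ∈ X) (hy : Dominated f y) : y ∈ X := by
  obtain ⟨s, hs, hy⟩ := hy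
  obtain ⟨k, hk⟩ := pow_unbounded_of_one_lt s one_lt_two
  obtain ⟨z, hz, h⟩ := hX.exists_dilation hf k
  refine hX.symm ((2 : ℝ) ^ k • z) (X.smul_mem _ hz) y fun t ht => ?_
  -- The dilated copies say nothing at t = 1, but y*(1) = 0.
  rcases ht.2.eq_or_lt with rfl | ht1
  · rw [rearr_eq_zero le_rfl]
    exact rearr_nonneg _ _
  rw [rearr_congr (Lp.coeFn_smul _ z), rearr_smul (aemeasurable_coe z) _ ht.1,
    abs_of_pos (by positivity)]
  calc rearr y t ≤ s * rearr f (t / s) := hy t ht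
    _ ≤ 2 ^ k * rearr f (t / 2 ^ k) :=
        mul_rearr_div_mono f (by linarith) hk.le (by linarith) hk.le ht.1
    _ ≤ 2 ^ k * rearr z t := mul_le_mul_of_nonneg_left (h t ⟨ht.1, ht1⟩) (by positivity)

lemma dominated_self (f : L1) : Dominated f f := ⟨1, le_rfl, fun t _ => by simp⟩

/-- Any symmetric ideal contains the dilates of f* by iterated doubling. Conversely the dominated
functions form such an ideal; f ≠ 0 is what puts L^∞ inside it. -/
lemma mem_symIdeal_iff {f : L1} (hf : f ≠ 0) {x : L1} : x ∈ symIdeal f ↔ Dominated f x := by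
  rw [symIdeal, Submodule.mem_sInf]
  refine ⟨fun h => h (dominatedSubmodule f)
    ⟨isSymmetricIdeal_dominatedSubmodule hf, dominated_self f⟩, ?_⟩
  rintro h X ⟨hX, hfX⟩
  exact hX.mem_of_dominated hfX h

lemma symIdeal_eq {f : L1} (hf : f ≠ 0) : symIdeal f = dominatedSubmodule f :=
  Submodule.ext fun _ => mem_symIdeal_iff hf

/-! ### Growth conditions on `ψ_f` -/

/-- `ψ_f` is at least halved by a suitable dilation. -/
def Halving (f : L1) : Prop :=
  ∃ s ∈ Ioo (0 : ℝ) 1, ∀ t ∈ Ioc (0 : ℝ) 1, psi f (s * t) ≤ psi f t / 2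

/-- `f** ≤ K f*` near zero. -/
def RegularNearZero (f : L1) : Prop :=
  ∃ K > (0 : ℝ), ∃ δ > (0 : ℝ), ∀ t ∈ Ioo (0 : ℝ) δ, maximalFn f t ≤ K * rearr f t

lemma RegularNearZero.exists_lt_one {f : L1} (h : RegularNearZero f) :
    ∃ K > (0 : ℝ), ∃ δ ∈ Ioo (0 : ℝ) 1, ∀ t ∈ Ioc (0 : ℝ) δ, maximalFn f t ≤ K * rearr f t := by
  obtain ⟨K, hK, δ, hδ, h⟩ := h
  have h1 : 0 < min δ 1 := lt_min hδ one_pos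
  exact ⟨K, hK, min δ 1 / 2, ⟨half_pos h1, by linarith [min_le_right δ 1]⟩,
    fun t ht => h t ⟨ht.1, by linarith [ht.2, min_le_left δ 1]⟩⟩

/-- By concavity ψ(2t) - ψ(t) ≥ t f*(2t), and regularity at 2t bounds this below by ψ(2t)/(2K) ≥
ψ(t)/(2K). -/
lemma RegularNearZero.doubling {f : L1} (h : RegularNearZero f) :
    ∃ q > (1 : ℝ), ∃ δ ∈ Ioo (0 : ℝ) 1, ∀ t ∈ Ioc (0 : ℝ) δ, 2 * t ≤ 1 ∧
      q * psi f t ≤ psi f (2 * t) := by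
  obtain ⟨K, hK, δ, hδ, h⟩ := h.exists_lt_one
  have hi := L1.integrable_coeFn f
  refine ⟨1 + 1 / (2 * K), by simp [hK], δ / 2, ⟨half_pos hδ.1, by linarith [hδ.2, hδ.1]⟩,
    fun t ht => ?_⟩
  have h2 : 2 * t ≤ δ := by linarith [ht.2]
  have h21 : 2 * t ≤ 1 := h2.trans hδ.2.le
  have h3 : 0 < 2 * t := by linarith [ht.1]
  refine ⟨h21, ?_⟩
  have h4 := h (2 * t) ⟨h3, h2⟩
  have h5 := psi_add_le_psi hi ht.1.le (by linarith [ht.1] : t ≤ 2 * t) h21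
  have h6 := psi_mono hi ht.1.le (by linarith [ht.1] : t ≤ 2 * t) h21
  rw [maximalFn, inv_mul_le_iff₀ h3] at h4
  have h7 : psi f t / (2 * K) ≤ t * rearr f (2 * t) := by
    rw [div_le_iff₀ (by positivity)]
    linarith
  calc (1 + 1 / (2 * K)) * psi f t = psi f t + psi f t / (2 * K) := by ring
    _ ≤ psi f t + (2 * t - t) * rearr f (2 * t) := by linarith
    _ ≤ _ := h5

lemma psi_two_mul_le {x : ℝ → ℝ} (hx : Integrable x lam) {t : ℝ} (ht : 0 < t) (ht1 : 2 * t ≤ 1) :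
    psi x (2 * t) ≤ 2 * psi x t := by
  have h1 := psi_le_psi_add hx ht (by linarith : t ≤ 2 * t) ht1
  have h2 := mul_rearr_le_psi hx ht.le (by linarith)
  linarith

/-- Conversely to `doubling`, concavity gives ψ(2t) ≤ ψ(t) + t f*(t), so ψ(2t) ≥ qψ(t) yields (q -
1) f**(t) ≤ f*(t). -/
lemma regularNearZero_iff_liminf {f : L1} (hf : f ≠ 0) : RegularNearZero f ↔
    1 < liminf (fun t : ℝ => psi f (2 * t) / psi f t) (𝓝[>] 0) := by
  have hi := L1.integrable_coeFn f
  constructor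
  · intro h
    obtain ⟨q, hq, δ, hδ, h⟩ := h.doubling
    refine hq.trans_le ?_
    have hm : Ioo 0 δ ∈ 𝓝[>] (0 : ℝ) := Ioo_mem_nhdsGT hδ.1
    refine le_liminf_of_le ?_ ?_
    -- A real `liminf` is meaningful only under boundedness; concavity keeps the quotient at most 2.
    · refine isCoboundedUnder_ge_of_eventually_le (x := 2) _ ?_
      filter_upwards [hm] with t ht
      have h1 : 2 * t ≤ 1 := (h t ⟨ht.1, ht.2.le⟩).1
      rw [div_le_iff₀ (psi_pos hf ht.1 (ht.2.le.trans hδ.2.le))]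
      exact psi_two_mul_le hi ht.1 h1
    · filter_upwards [hm] with t ht
      rw [le_div_iff₀ (psi_pos hf ht.1 (ht.2.le.trans hδ.2.le))]
      exact (h t ⟨ht.1, ht.2.le⟩).2
  · intro h
    obtain ⟨q, hq, hq'⟩ := exists_between h
    have hb : IsBoundedUnder (· ≥ ·) (𝓝[>] (0 : ℝ)) fun t : ℝ => psi f (2 * t) / psi f t :=
      isBoundedUnder_of ⟨0, fun t => div_nonneg (psi_nonneg _ _) (psi_nonneg _ _)⟩
    have h1 := (eventually_lt_of_lt_liminf hq' hb).and
      (Ioo_mem_nhdsGT (show (0 : ℝ) < 1 / 2 by norm_num))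
    obtain ⟨δ, hδ, h2⟩ := mem_nhdsGT_iff_exists_Ioo_subset.1 h1
    refine ⟨1 / (q - 1), by simp [hq], δ, hδ, fun t ht => ?_⟩
    obtain ⟨h3, h4⟩ := h2 ht
    have h21 : 2 * t ≤ 1 := by linarith [h4.2]
    rw [lt_div_iff₀ (psi_pos hf ht.1 (by linarith [h4.2]))] at h3
    have h5 := psi_le_psi_add hi ht.1 (by linarith [ht.1] : t ≤ 2 * t) h21
    rw [maximalFn, inv_mul_le_iff₀ ht.1, one_div, ← mul_assoc, mul_comm t, mul_assoc,
      le_inv_mul_iff₀ (by linarith)]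
    linarith

lemma psi_iterate {x : ℝ → ℝ} {q a δ : ℝ} (hq : 0 < q) (ha : a ∈ Ioo (0 : ℝ) 1)
    (h : ∀ t ∈ Ioc (0 : ℝ) δ, q * psi x (a * t) ≤ psi x t) (n : ℕ) :
    ∀ t ∈ Ioc (0 : ℝ) δ, q ^ n * psi x (a ^ n * t) ≤ psi x t := by
  induction n with
  | zero => simp
  | succ n ih =>
    intro t ht
    have h1 : a * t ∈ Ioc 0 δ := ⟨mul_pos ha.1 ht.1,
      (mul_le_of_le_one_left ht.1.le ha.2.le).trans ht.2⟩
    calc q ^ (n + 1) * psi x (a ^ (n + 1) * t) = q * (q ^ n * psi x (a ^ n * (a * t))) := by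
          rw [pow_succ', pow_succ, mul_assoc, mul_assoc]
      _ ≤ q * psi x (a * t) := mul_le_mul_of_nonneg_left (ih _ h1) hq.le
      _ ≤ _ := h t ht

/-- For t ≤ δ the doubling inequality is iterated until qⁿ > 2. For t > δ it suffices that st ≤ η
with ψ ≤ ψ(δ)/2 on [0, η]. The minimum of the two factors serves every t. -/
lemma RegularNearZero.halving {f : L1} (hf : f ≠ 0) (h : RegularNearZero f) : Halving f := by
  have hi := L1.integrable_coeFn f
  obtain ⟨q, hq, δ, hδ, h⟩ := h.doubling
  have hstep : ∀ t ∈ Ioc (0 : ℝ) δ, q * psi f (1 / 2 * t) ≤ psi f t := fun t ht => by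
    have := (h (1 / 2 * t) ⟨by linarith [ht.1], by linarith [ht.2, ht.1]⟩).2
    rwa [← mul_assoc, mul_one_div_cancel two_ne_zero, one_mul] at this
  obtain ⟨n, hn⟩ := pow_unbounded_of_one_lt 2 hq
  obtain ⟨η, hη, h1⟩ := exists_psi_le hi (half_pos (psi_pos hf hδ.1 hδ.2.le))
  have h2 : (0 : ℝ) < (1 / 2) ^ n := by positivity
  have h3 : 0 < min η ((1 / 2) ^ n) := lt_min hη.1 h2
  refine ⟨min η ((1 / 2) ^ n), ⟨h3, (min_le_left _ _).trans_lt hη.2⟩, fun t ht => ?_⟩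
  have h4 : 0 ≤ min η ((1 / 2) ^ n) * t := mul_nonneg h3.le ht.1.le
  rcases le_or_gt t δ with htδ | htδ
  · have h5 := psi_iterate (by linarith) ⟨by norm_num, by norm_num⟩ hstep n t ⟨ht.1, htδ⟩
    have h6 : psi f (min η ((1 / 2) ^ n) * t) ≤ psi f ((1 / 2) ^ n * t) :=
      psi_mono hi h4 (mul_le_mul_of_nonneg_right (min_le_right _ _) ht.1.le)
        (mul_le_one₀ (pow_le_one₀ (by norm_num) (by norm_num)) ht.1.le ht.2)
    have h7 := mul_le_mul_of_nonneg_right hn.le (psi_nonneg f ((1 / 2) ^ n * t))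
    linarith
  · have h5 : min η ((1 / 2) ^ n) * t ≤ η :=
      (mul_le_of_le_one_right h3.le ht.2).trans (min_le_left _ _)
    have h6 := psi_mono hi hδ.1.le htδ.le ht.2
    linarith [h1 _ ⟨h4, h5⟩]

/-- Halving at t = u/s says that at least half of ψ(u/s) is accumulated on (u, u/s], where f* ≤
f*(u). -/
lemma Halving.regularNearZero {f : L1} (h : Halving f) : RegularNearZero f := by
  have hi := L1.integrable_coeFn f
  obtain ⟨s, hs, h⟩ := h
  have hs0 := hs.1
  refine ⟨2 / s, by positivity, s, hs0, fun u hu => ?_⟩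
  have ht : u / s ∈ Ioc (0 : ℝ) 1 := ⟨div_pos hu.1 hs0, (div_le_one hs0).2 hu.2.le⟩
  have hut : u ≤ u / s := by
    rw [le_div_iff₀ hs0]
    exact mul_le_of_le_one_right hu.1.le hs.2.le
  have h1 := h _ ht
  rw [mul_div_cancel₀ _ hs0.ne'] at h1
  have h2 := psi_le_psi_add hi hu.1 hut ht.2
  have h3 := mul_nonneg hu.1.le (rearr_nonneg f u)
  have h4 := mul_nonneg (sub_nonneg.2 hut) (rearr_nonneg f u)
  rw [maximalFn, inv_mul_le_iff₀ hu.1]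
  calc psi f u ≤ 2 * ((u / s - u) * rearr f u) := by linarith
    _ ≤ 2 * (u / s * rearr f u) := by linarith
    _ = u * (2 / s * rearr f u) := by ring

lemma regularNearZero_iff_halving {f : L1} (hf : f ≠ 0) : RegularNearZero f ↔ Halving f :=
  ⟨fun h => h.halving hf, fun h => h.regularNearZero⟩

lemma Halving.power_bound {f : L1} (h : Halving f) : ∃ r ∈ Ioo (0 : ℝ) 1,
    ∀ s ∈ Ioc (0 : ℝ) 1, ∀ t ∈ Ioc (0 : ℝ) 1, psi f (s * t) ≤ 2 * s ^ r * psi f t := by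
  have hi := L1.integrable_coeFn f
  obtain ⟨s₀, hs₀, h⟩ := h
  -- The exponent r solves a^r = 1/2; taking a ≤ 1/4 guarantees r < 1.
  set a : ℝ := min s₀ (1 / 4) with ha
  have ha0 : 0 < a := lt_min hs₀.1 (by norm_num)
  have ha4 : a ≤ 1 / 4 := min_le_right _ _
  have ha1 : a < 1 := by linarith
  have hstep : ∀ t ∈ Ioc (0 : ℝ) 1, 2 * psi f (a * t) ≤ psi f t := fun t ht => by
    have h1 := h t ht
    have h2 : psi f (a * t) ≤ psi f (s₀ * t) := psi_mono hi (mul_nonneg ha0.le ht.1.le)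
      (mul_le_mul_of_nonneg_right (min_le_left _ _) ht.1.le)
      (mul_le_one₀ hs₀.2.le ht.1.le ht.2)
    linarith
  have hla : Real.log a < 0 := Real.log_neg ha0 ha1
  have hl2 : 0 < Real.log 2 := Real.log_pos one_lt_two
  have hr : a ^ (-(Real.log 2 / Real.log a)) = 1 / 2 := by
    rw [Real.rpow_def_of_pos ha0, mul_neg, mul_div_cancel₀ _ hla.ne, Real.exp_neg,
      Real.exp_log two_pos, one_div]
  have hr0 : 0 < -(Real.log 2 / Real.log a) := neg_pos.2 (div_neg_of_pos_of_neg hl2 hla)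
  refine ⟨-(Real.log 2 / Real.log a), ⟨hr0, ?_⟩, fun s hs t ht => ?_⟩
  · by_contra! hc
    have := Real.rpow_le_rpow_of_exponent_ge ha0 ha1.le hc
    rw [hr, Real.rpow_one] at this
    linarith
  -- With a^(n+1) < s ≤ a^n only n halvings are available where s^r ≥ (1/2)^(n+1); the lost step is
  -- the constant 2.
  · obtain ⟨n, hn, hn'⟩ := exists_nat_pow_near_of_lt_one hs.1 hs.2 ha0 ha1
    have h1 := psi_iterate two_pos ⟨ha0, ha1⟩ hstep n t ht
    have h2 : psi f (s * t) ≤ psi f (a ^ n * t) := psi_mono hi (mul_nonneg hs.1.le ht.1.le)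
      (mul_le_mul_of_nonneg_right hn' ht.1.le)
      (mul_le_one₀ (pow_le_one₀ ha0.le ha1.le) ht.1.le ht.2)
    have h3 : (1 / 2 : ℝ) ^ (n + 1) ≤ s ^ (-(Real.log 2 / Real.log a)) := by
      rw [← hr, ← Real.rpow_natCast, ← Real.rpow_mul ha0.le, mul_comm, Real.rpow_mul ha0.le,
        Real.rpow_natCast]
      exact Real.rpow_le_rpow (by positivity) hn.le hr0.le
    have h4 : psi f (a ^ n * t) ≤ 2 * (1 / 2 : ℝ) ^ (n + 1) * psi f t := by
      calc psi f (a ^ n * t) = (1 / 2) ^ n * (2 ^ n * psi f (a ^ n * t)) := by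
            rw [← mul_assoc, ← mul_pow]
            norm_num
        _ ≤ (1 / 2) ^ n * psi f t := mul_le_mul_of_nonneg_left h1 (by positivity)
        _ = _ := by rw [pow_succ]; ring
    exact h2.trans (h4.trans (mul_le_mul_of_nonneg_right (by linarith) (psi_nonneg _ _)))

/-! ### Dilations on the Marcinkiewicz space -/

lemma rearr_dil_le {x : ℝ → ℝ} (hx : AEMeasurable x lam) {s t : ℝ} (hs : 0 < s) (ht : 0 < t) :
    rearr (dil s x) t ≤ rearr x (s * t) := by
  have hc := rearr_nonneg x (s * t)
  refine rearr_le_of_measure_le hc ?_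
  rw [lam_apply]
  have hsub : {u | rearr x (s * t) < |dil s x u|} ∩ Ioc 0 1 ⊆
      (s * ·) ⁻¹' ({u | rearr x (s * t) < |x u|} ∩ Ioc 0 1) := by
    rintro u ⟨hu, -⟩
    have hu' : u ∈ {t | 0 < s * t ∧ s * t ≤ 1} := by
      by_contra h
      simp only [dil, mem_ofPred_eq, indicator_of_notMem h, abs_zero] at hu
      exact absurd hu (not_lt.2 hc)
    simp only [dil, mem_ofPred_eq, indicator_of_mem hu'] at hu
    exact ⟨hu, hu'⟩
  refine (measure_mono hsub).trans ?_
  rw [Real.volume_preimage_mul_left hs.ne', ← lam_apply, abs_of_pos (inv_pos.2 hs)]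
  calc _ ≤ ENNReal.ofReal s⁻¹ * ENNReal.ofReal (s * t) := by
        gcongr
        exact measure_rearr_lt hx (mul_pos hs ht)
    _ = ENNReal.ofReal t := by
        rw [← ENNReal.ofReal_mul (inv_nonneg.2 hs.le), inv_mul_cancel_left₀ hs.ne']

lemma psi_dil_le {x : ℝ → ℝ} (hx : Integrable x lam) {s t : ℝ} (hs : 0 < s) (ht : 0 < t)
    (hst : s * t ≤ 1) : psi (dil s x) t ≤ s⁻¹ * psi x (s * t) := by
  rw [← integral_rearr_mul x hs ht.le]
  exact integral_mono_of_nonneg (ae_of_all _ fun _ => rearr_nonneg _ _)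
    (integrableOn_rearr_mul hx hs ht.le hst)
    ((ae_restrict_iff' measurableSet_Ioc).2 (ae_of_all _ fun u hu =>
      rearr_dil_le hx.aemeasurable hs hu.1))

lemma aemeasurable_dil (x : L1) (s : ℝ) : AEMeasurable (dil s x) lam := by
  have h1 : Measurable x := (Lp.stronglyMeasurable x).measurable
  have h2 : Measurable fun t : ℝ => s * t := measurable_const_mul s
  exact ((h1.comp h2).indicator (h2 measurableSet_Ioc)).aemeasurable

/-- For a decreasing function the bound of `rearr_dil_le` is sharp, since its large values sit near
zero, where the dilation sees them. At t = 1 the right side is 0 but f*(s) need not be. -/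
lemma le_rearr_dil_rearrL (f : L1) {s t : ℝ} (hs : s ∈ Ioc (0 : ℝ) 1) (ht : t ∈ Ioo (0 : ℝ) 1) :
    rearr f (s * t) ≤ rearr (dil s (rearrL f)) t := by
  refine le_of_forall_lt_imp_le_of_dense fun c hc => ?_
  rcases lt_or_ge c 0 with hc0 | hc0
  · exact hc0.le.trans (rearr_nonneg _ _)
  have hst := mul_pos hs.1 ht.1
  have hfm := aemeasurable_coe f
  obtain ⟨v, hv, hcv⟩ := exists_gt_lt_rearr hfm hc0 hst (mul_lt_of_lt_one_right hs.1 ht.2) hc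
  refine ((lt_rearr_iff (aemeasurable_dil _ s) ht.1 hc0).2 ?_).le
  have hv0 : 0 < v := hst.trans hv.1
  have hsub : (s * ·) ⁻¹' ({u | c < |rearrL f u|} ∩ Ioc 0 v) ⊆
      {u | c < |dil s (rearrL f) u|} ∩ Ioc 0 1 := by
    rintro u ⟨hu, hu'⟩
    have h1 : u ∈ {t | 0 < s * t ∧ s * t ≤ 1} := ⟨hu'.1, hu'.2.trans (hv.2.trans hs.2)⟩
    refine ⟨?_, pos_of_mul_pos_right hu'.1 hs.1.le, ?_⟩
    · simp only [dil, mem_ofPred_eq, indicator_of_mem h1]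
      exact hu
    · have := hu'.2.trans hv.2
      exact le_of_mul_le_mul_left (by linarith) hs.1
  rw [lam_apply]
  refine lt_of_lt_of_le ?_ (measure_mono hsub)
  rw [Real.volume_preimage_mul_left hs.1.ne', abs_of_pos (inv_pos.2 hs.1)]
  have h2 : Ioc 0 v ≤ᵐ[volume] ({u | c < |rearrL f u|} ∩ Ioc 0 v : Set ℝ) := by
    have h3 := (ae_restrict_iff' measurableSet_Ioc).1 (coeFn_rearrL f)
    filter_upwards [h3] with u hu hu'
    refine ⟨?_, hu'⟩
    have h4 : rearrL f u = rearr f u := hu ⟨hu'.1, hu'.2.trans (hv.2.trans hs.2)⟩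
    simp only [mem_ofPred_eq, h4, abs_of_nonneg (rearr_nonneg _ _)]
    exact hcv.trans_le (rearr_antitone hfm hu'.1 hu'.2)
  have h5 := measure_mono_ae h2
  rw [Real.volume_Ioc, sub_zero] at h5
  calc ENNReal.ofReal t < ENNReal.ofReal (s⁻¹ * v) := by
        refine (ENNReal.ofReal_lt_ofReal_iff (mul_pos (inv_pos.2 hs.1) hv0)).2 ?_
        rw [lt_inv_mul_iff₀ hs.1]
        exact hv.1
    _ = ENNReal.ofReal s⁻¹ * ENNReal.ofReal v := ENNReal.ofReal_mul (inv_nonneg.2 hs.1.le)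
    _ ≤ _ := by gcongr

lemma le_psi_dil_rearrL (f : L1) {s t : ℝ} (hs : s ∈ Ioc (0 : ℝ) 1) (ht : t ∈ Ioc (0 : ℝ) 1) :
    s⁻¹ * psi f (s * t) ≤ psi (dil s (rearrL f)) t := by
  have hi := L1.integrable_coeFn f
  have hint := integrableOn_rearr_mul hi hs.1 ht.1.le (mul_le_one₀ hs.2 ht.1.le ht.2)
  rw [← integral_rearr_mul f hs.1 ht.1.le]
  refine setIntegral_mono_on_ae hint ?_ measurableSet_Ioc ?_
  · refine Integrable.mono' hint (aemeasurable_of_antitoneOn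
      (rearr_antitoneOn (aemeasurable_dil _ s)) t).aestronglyMeasurable ?_
    refine (ae_restrict_iff' measurableSet_Ioc).2 (ae_of_all _ fun u hu => ?_)
    rw [Real.norm_of_nonneg (rearr_nonneg _ _), ← rearr_rearrL]
    exact rearr_dil_le (aemeasurable_coe _) hs.1 hu.1
  · have : ∀ᵐ u : ℝ, u ≠ 1 := compl_mem_ae_iff.2 (measure_singleton 1)
    filter_upwards [this] with u hu hu'
    exact le_rearr_dil_rearrL f hs ⟨hu'.1, lt_of_le_of_ne (hu'.2.trans ht.2) hu⟩

lemma le_marcNorm (f : L1) (g : ℝ → ℝ) {t : ℝ} (ht : t ∈ Ioc (0 : ℝ) 1) :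
    ENNReal.ofReal (psi g t / psi f t) ≤ marcNorm f g :=
  le_iSup₂_of_le t ht le_rfl

lemma marcNorm_rearrL {f : L1} (hf : f ≠ 0) : marcNorm f (rearrL f) = 1 := by
  have : ∀ t ∈ Ioc (0 : ℝ) 1, psi (rearrL f) t / psi f t = 1 := fun t ht => by
    rw [psi_congr (coeFn_rearrL f), psi_rearr (aemeasurable_coe f),
      div_self (psi_pos hf ht.1 ht.2).ne']
  refine le_antisymm (iSup₂_le fun t ht => by simp [this t ht]) ?_
  have h1 : (1 : ℝ) ∈ Ioc (0 : ℝ) 1 := ⟨one_pos, le_rfl⟩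
  simpa [this 1 h1] using le_marcNorm f (rearrL f) h1

/-- The bound ψ_{ρ_s x}(t) ≤ s⁻¹ψ_x(st) is attained at x = f*, so the norm of ρ_s is the supremum of
ψ(st)/(sψ(t)). The power bound with exponent r gives p = 1 - r; conversely p < 1 lets k s^(1-p) drop
below 1/2. -/
lemma halving_iff_dilNorm {f : L1} (hf : f ≠ 0) : Halving f ↔
    ∃ k > (0 : ℝ), ∃ p ∈ Ioo (0 : ℝ) 1, ∀ s ∈ Ioc (0 : ℝ) 1,
      dilNorm f s ≤ ENNReal.ofReal (k * s ^ (-p)) := by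
  have hfi := L1.integrable_coeFn f
  constructor
  · intro h
    obtain ⟨r, hr, h⟩ := h.power_bound
    refine ⟨2, two_pos, 1 - r, ⟨by linarith [hr.2], by linarith [hr.1]⟩, fun s hs => ?_⟩
    refine iSup₂_le fun x hx => iSup₂_le fun t ht => ENNReal.ofReal_le_ofReal ?_
    have hst : s * t ∈ Ioc (0 : ℝ) 1 := ⟨mul_pos hs.1 ht.1, mul_le_one₀ hs.2 ht.1.le ht.2⟩
    have h1 := le_marcNorm f x hst
    rw [hx, ENNReal.ofReal_le_one, div_le_one (psi_pos hf hst.1 hst.2)] at h1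
    have h2 := psi_dil_le (L1.integrable_coeFn x) hs.1 ht.1 hst.2
    rw [div_le_iff₀ (psi_pos hf ht.1 ht.2)]
    have h3 : s ^ (-(1 - r)) = s⁻¹ * s ^ r := by
      rw [neg_sub, Real.rpow_sub hs.1, Real.rpow_one, div_eq_inv_mul]
    calc psi (dil s x) t ≤ s⁻¹ * psi x (s * t) := h2
      _ ≤ s⁻¹ * (2 * s ^ r * psi f t) :=
          mul_le_mul_of_nonneg_left (h1.trans (h s hs t ht)) (inv_nonneg.2 hs.1.le)
      _ = 2 * s ^ (-(1 - r)) * psi f t := by rw [h3]; ring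
  · rintro ⟨k, hk, p, hp, h⟩
    have hlim : Tendsto (fun s : ℝ => k * s ^ (1 - p)) (𝓝[>] 0) (𝓝 0) := by
      have : ContinuousAt (fun s : ℝ => k * s ^ (1 - p)) 0 :=
        continuousAt_const.mul (Real.continuousAt_rpow_const _ _ (Or.inr (by linarith [hp.2])))
      have h0 := this.tendsto
      rw [Real.zero_rpow (by linarith [hp.2]), mul_zero] at h0
      exact h0.mono_left nhdsWithin_le_nhds
    obtain ⟨s, hs, hs'⟩ := ((hlim.eventually (gt_mem_nhds (by norm_num : (0 : ℝ) < 1 / 2))).and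
      (Ioo_mem_nhdsGT (zero_lt_one' ℝ))).exists
    have hs1 : s ∈ Ioc (0 : ℝ) 1 := ⟨hs'.1, hs'.2.le⟩
    refine ⟨s, hs', fun t ht => ?_⟩
    have h1 : ENNReal.ofReal (psi (dil s (rearrL f)) t / psi f t) ≤
        ENNReal.ofReal (k * s ^ (-p)) :=
      (le_marcNorm f _ ht).trans ((le_iSup₂_of_le (rearrL f) (marcNorm_rearrL hf) le_rfl).trans
        (h s hs1))
    rw [ENNReal.ofReal_le_ofReal_iff (mul_nonneg hk.le (Real.rpow_nonneg hs'.1.le _)),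
      div_le_iff₀ (psi_pos hf ht.1 ht.2)] at h1
    have h2 := (le_psi_dil_rearrL f hs1 ht).trans h1
    rw [inv_mul_le_iff₀ hs'.1] at h2
    have h3 : s * (k * s ^ (-p) * psi f t) = k * s ^ (1 - p) * psi f t := by
      rw [sub_eq_add_neg, Real.rpow_add hs'.1, Real.rpow_one]
      ring
    rw [h3] at h2
    have := mul_le_mul_of_nonneg_right hs.le (psi_nonneg f t)
    linarith

/-! ### Regularity -/

lemma RegularNearZero.maximalFn_le {f : L1} (h : RegularNearZero f) :
    ∃ K M : ℝ, 0 ≤ K ∧ 0 ≤ M ∧ ∀ t ∈ Ioc (0 : ℝ) 1, maximalFn f t ≤ K * rearr f t + M := by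
  have hi := L1.integrable_coeFn f
  obtain ⟨K, hK, δ, hδ, h⟩ := h.exists_lt_one
  refine ⟨K, maximalFn f δ, hK.le, maximalFn_nonneg _ hδ.1.le, fun t ht => ?_⟩
  rcases le_or_gt t δ with htδ | htδ
  · exact (h t ⟨ht.1, htδ⟩).trans (le_add_of_nonneg_right (maximalFn_nonneg _ hδ.1.le))
  · exact (maximalFn_antitoneOn hi ⟨hδ.1, hδ.2.le⟩ ht htδ.le).trans
      (le_add_of_nonneg_left (mul_nonneg hK.le (rearr_nonneg _ _)))

lemma RegularNearZero.exists_eq_maximalFn {f : L1} (hf : f ≠ 0) (h : RegularNearZero f) :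
    ∃ g ∈ symIdeal f, (g : ℝ → ℝ) =ᵐ[lam] maximalFn f := by
  have hfi := L1.integrable_coeFn f
  have hfm := aemeasurable_coe f
  obtain ⟨K, M, hK, hM, h⟩ := h.maximalFn_le
  have hKM : ∀ᵐ u ∂lam, |maximalFn f u| ≤ |(K • rearr f) u| + M := by
    filter_upwards [ae_lam_mem] with u hu
    rw [abs_of_nonneg (maximalFn_nonneg _ hu.1.le), Pi.smul_apply, smul_eq_mul,
      abs_of_nonneg (mul_nonneg hK (rearr_nonneg _ _))]
    exact h u hu
  have hi : Integrable (maximalFn f) lam := by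
    refine Integrable.mono' (((integrable_rearr hfi).smul K).abs.add (integrable_const M))
      (aemeasurable_restrict_of_antitoneOn measurableSet_Ioc
        (maximalFn_antitoneOn hfi)).aestronglyMeasurable hKM
  refine ⟨hi.toL1 _, (mem_symIdeal_iff hf).2 ?_, hi.coeFn_toL1⟩
  refine dominated_of_le_add hf hK hM le_rfl fun t ht => ?_
  rw [rearr_congr hi.coeFn_toL1, div_one]
  have h1 := rearr_le_rearr_add ((aemeasurable_rearr hfm).const_smul K) hM hKM ht.1
  rwa [rearr_smul (aemeasurable_rearr hfm) K ht.1, abs_of_nonneg hK, rearr_rearr hfm] at h1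

/-- `f**` is dominated near zero by a dilation of `f*`. -/
def WeaklyRegular (f : L1) : Prop :=
  ∃ s, 1 ≤ s ∧ ∃ δ > (0 : ℝ), ∀ t ∈ Ioo (0 : ℝ) δ, maximalFn f t ≤ s * rearr f (t / s)

/-- The dilation costs nothing: evaluate at ts instead of t and use ψ(t) ≤ ψ(ts), which turns the
constant s into s². -/
lemma WeaklyRegular.regularNearZero {f : L1} (h : WeaklyRegular f) : RegularNearZero f := by
  have hfi := L1.integrable_coeFn f
  obtain ⟨s, hs, δ, hδ, h⟩ := h
  have hs0 : 0 < s := by linarith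
  have h1 : 0 < min δ 1 / s := div_pos (lt_min hδ one_pos) hs0
  refine ⟨s * s, by positivity, min δ 1 / s, h1, fun t ht => ?_⟩
  have h2 : t * s < min δ 1 := (lt_div_iff₀ hs0).1 ht.2
  have h3 := h (t * s) ⟨mul_pos ht.1 hs0, h2.trans_le (min_le_left _ _)⟩
  rw [mul_div_cancel_right₀ _ hs0.ne', maximalFn, inv_mul_le_iff₀ (mul_pos ht.1 hs0)] at h3
  have h4 := psi_mono hfi ht.1.le (le_mul_of_one_le_right ht.1.le hs)
    (h2.le.trans (min_le_right _ _))
  rw [maximalFn, inv_mul_le_iff₀ ht.1]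
  calc psi f t ≤ t * s * (s * rearr f t) := h4.trans h3
    _ = _ := by ring

/-- As f** decreases, it is at least f**(2t) on (0, 2t], so g*(t) ≥ f**(2t). Leaving the room
between t and 2t costs only a factor 2, because f**(t) ≤ 2 f**(2t). -/
lemma WeaklyRegular.of_eq_maximalFn {f : L1} (hf : f ≠ 0)
    (h : ∃ g ∈ symIdeal f, (g : ℝ → ℝ) =ᵐ[lam] maximalFn f) : WeaklyRegular f := by
  have hfi := L1.integrable_coeFn f
  obtain ⟨g, hg, hgf⟩ := h
  obtain ⟨s, hs, hg⟩ := (mem_symIdeal_iff hf).1 hg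
  refine ⟨2 * s, by linarith, 1 / 2, by norm_num, fun t ht => ?_⟩
  have h2 : 2 * t ∈ Ioc (0 : ℝ) 1 := ⟨by linarith [ht.1], by linarith [ht.2]⟩
  have h1 : maximalFn f (2 * t) ≤ rearr g t := by
    refine le_rearr_of_forall (aemeasurable_coe g) ht.1 (by linarith [ht.1] : t < 2 * t) h2.2 ?_
    filter_upwards [hgf] with u hu hu'
    rw [hu, abs_of_nonneg (maximalFn_nonneg _ hu'.1.le)]
    exact maximalFn_antitoneOn hfi ⟨hu'.1, hu'.2.trans h2.2⟩ h2 hu'.2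
  have h3 : maximalFn f t ≤ 2 * maximalFn f (2 * t) := by
    have := psi_mono hfi ht.1.le (by linarith [ht.1] : t ≤ 2 * t) h2.2
    rw [maximalFn, inv_mul_le_iff₀ ht.1]
    calc psi f t ≤ psi f (2 * t) := this
      _ = 2 * t * maximalFn f (2 * t) := (mul_maximalFn _ h2.1).symm
      _ = _ := by ring
  have h4 := hg t ⟨ht.1, by linarith [ht.2]⟩
  calc maximalFn f t ≤ 2 * s * rearr f (t / s) := by linarith
    _ ≤ _ := mul_rearr_div_mono f (by linarith) le_rfl (by linarith) (by linarith) ht.1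

lemma Dominated.maximalFn_le {f x : L1} {s : ℝ} (hs : 1 ≤ s)
    (h : ∀ t ∈ Ioc (0 : ℝ) 1, rearr x t ≤ s * rearr f (t / s)) {t : ℝ} (ht : t ∈ Ioc (0 : ℝ) 1) :
    maximalFn x t ≤ s * maximalFn f (t / s) := by
  have hfi := L1.integrable_coeFn f
  have hs0 : 0 < s := by linarith
  have h1 : psi x t ≤ s * (s * psi f (t / s)) := by
    have h2 := integral_rearr_mul f (inv_pos.2 hs0) ht.1.le
    rw [inv_inv, inv_mul_eq_div] at h2
    rw [← h2, ← integral_const_mul]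
    refine integral_mono_of_nonneg (ae_of_all _ fun _ => rearr_nonneg _ _) ?_ ?_
    · exact (integrableOn_rearr_mul hfi (inv_pos.2 hs0) ht.1.le
        (mul_le_one₀ (inv_le_one_of_one_le₀ hs) ht.1.le ht.2)).const_mul s
    · refine (ae_restrict_iff' measurableSet_Ioc).2 (ae_of_all _ fun u hu => ?_)
      have := h u ⟨hu.1, hu.2.trans ht.2⟩
      rwa [div_eq_inv_mul] at this
  rw [maximalFn, inv_mul_le_iff₀ ht.1]
  refine h1.trans_eq ?_
  rw [← mul_maximalFn f (div_pos ht.1 hs0)]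
  field_simp

/-- Domination passes to averages, x** ≤ s f**(·/s), and regularity replaces f** by K f* + M. Both
the averaging and the interpolation property of N_f reduce to this. -/
lemma RegularNearZero.dominated_of_le_maximalFn {f x y : L1} (hf : f ≠ 0) (h : RegularNearZero f)
    (hx : Dominated f x) {C : ℝ} (hC : 0 ≤ C)
    (hxy : ∀ t ∈ Ioc (0 : ℝ) 1, rearr y t ≤ C * maximalFn x t) : Dominated f y := by
  obtain ⟨K, M, hK, hM, h⟩ := h.maximalFn_le
  obtain ⟨s, hs, hx⟩ := hx
  have hs0 : 0 < s := by linarith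
  refine dominated_of_le_add hf (K := C * s * K) (M := C * s * M) (by positivity) (by positivity)
    hs fun t ht => ?_
  have h1 := h (t / s) ⟨div_pos ht.1 hs0, (div_le_one hs0).2 (ht.2.trans hs)⟩
  have h2 := Dominated.maximalFn_le hs hx ht
  calc rearr y t ≤ C * maximalFn x t := hxy t ht
    _ ≤ C * (s * (K * rearr f (t / s) + M)) := by gcongr; exact h2.trans (by gcongr)
    _ = _ := by ring

/-- On (1/2, 1) one has f** ≥ ψ(1/2), so the global inequality keeps f* away from zero up to t = 1,
which bounds |f| below. Conversely a lower bound for f* absorbs the additive constant of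
`maximalFn_le`. -/
lemma forall_maximalFn_le_iff {f : L1} (hf : f ≠ 0) :
    (∃ K > (0 : ℝ), ∀ t ∈ Ioo (0 : ℝ) 1, maximalFn f t ≤ K * rearr f t) ↔
      RegularNearZero f ∧ ∃ m > (0 : ℝ), ∀ᵐ u ∂lam, m ≤ |f u| := by
  have hfi := L1.integrable_coeFn f
  have hfm := aemeasurable_coe f
  constructor
  · rintro ⟨K, hK, h⟩
    refine ⟨⟨K, hK, 1, one_pos, h⟩, ?_⟩
    have h0 : 0 < psi f (1 / 2) := psi_pos hf (by norm_num) (by norm_num)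
    set m := psi f (1 / 2) / K with hm
    have hm0 : 0 < m := div_pos h0 hK
    have h1 : ∀ t ∈ Ioo (1 / 2 : ℝ) 1, m ≤ rearr f t := fun t ht => by
      have ht0 : 0 < t := by linarith [ht.1]
      have h2 := h t ⟨ht0, ht.2⟩
      rw [maximalFn, inv_mul_le_iff₀ ht0] at h2
      have h3 := psi_mono hfi (by norm_num) ht.1.le ht.2.le
      have h4 : t * (K * rearr f t) ≤ K * rearr f t :=
        mul_le_of_le_one_left (mul_nonneg hK.le (rearr_nonneg _ _)) ht.2.le
      rw [hm, div_le_iff₀ hK]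
      linarith
    -- Half of m leaves the strict inequality that `lt_rearr_iff` needs.
    refine ⟨m / 2, half_pos hm0, ?_⟩
    have h2 : lam {u | m / 2 < |f u|} = 1 := by
      refine le_antisymm prob_le_one ?_
      refine le_of_forall_lt_imp_le_of_dense fun a ha => ?_
      have ha' : a.toReal < 1 := by
        have := (ENNReal.toReal_lt_toReal ha.ne_top ENNReal.one_ne_top).2 ha
        simpa using this
      obtain ⟨t, ht, ht'⟩ := exists_between (max_lt ha' (by norm_num : (1 / 2 : ℝ) < 1))
      have ht2 : 1 / 2 < t := (le_max_right _ _).trans_lt ht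
      have h3 := (lt_rearr_iff hfm (by linarith) (half_pos hm0).le).1
        ((half_lt_self hm0).trans_le (h1 t ⟨ht2, ht'⟩))
      refine le_trans ?_ h3.le
      rw [← ENNReal.ofReal_toReal ha.ne_top]
      exact ENNReal.ofReal_le_ofReal ((le_max_left _ _).trans ht.le)
    have h3 : ∀ᵐ u ∂lam, m / 2 < |f u| := by
      have hn : NullMeasurableSet {u | m / 2 < |f u|} lam :=
        nullMeasurableSet_lt aemeasurable_const (measurable_norm.comp_aemeasurable hfm)
      exact (prob_compl_eq_zero_iff₀ hn).2 h2
    exact h3.mono fun u hu => hu.le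
  · rintro ⟨h, m, hm, hfm'⟩
    obtain ⟨K, M, hK, hM, h⟩ := h.maximalFn_le
    refine ⟨K + M / m + 1, by positivity, fun t ht => ?_⟩
    have h1 : m ≤ rearr f t :=
      le_rearr_of_forall hfm ht.1 ht.2 le_rfl (hfm'.mono fun u hu _ => hu)
    have h2 := h t ⟨ht.1, ht.2.le⟩
    have h3 : M ≤ M / m * rearr f t := by
      calc M = M / m * m := (div_mul_cancel₀ _ hm.ne').symm
        _ ≤ _ := mul_le_mul_of_nonneg_left h1 (by positivity)
    rw [add_mul, add_mul, one_mul]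
    linarith [rearr_nonneg f t]

/-! ### Conditional expectations -/

lemma measurableSet_lt_and_lt_neg {α : Type*} {m : MeasurableSpace α} {g : α → ℝ}
    (hg : StronglyMeasurable g) (c : ℝ) :
    MeasurableSet {u | c < g u} ∧ MeasurableSet {u | g u < -c} :=
  ⟨hg.measurable measurableSet_Ioi, hg.measurable measurableSet_Iio⟩

/-- For 0 < c < y*(t), the A-measurable sets {y > c} and {y < -c} have total measure τ > t. There
the conditional expectation may be replaced by x, so τc is at most the integral of |x|, and
Hardy–Littlewood gives c ≤ x**(τ) ≤ x**(t). -/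
lemma IsCondExp.rearr_le {A : MeasurableSpace ℝ} (hA : IsSigmaSubalgebra A) {x y : L1}
    (h : IsCondExp A x y) {t : ℝ} (ht : t ∈ Ioc (0 : ℝ) 1) : rearr y t ≤ maximalFn x t := by
  have hxi := L1.integrable_coeFn x
  have hyi := L1.integrable_coeFn y
  obtain ⟨⟨y', hy', hyy'⟩, h⟩ := h
  refine le_of_forall_lt_imp_le_of_dense fun c hc => ?_
  rcases le_or_gt c 0 with hc0 | hc0
  · exact hc0.trans (maximalFn_nonneg _ ht.1.le)
  set P := {u | c < y' u} with hP
  set Q := {u | y' u < -c} with hQ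
  obtain ⟨hPA, hQA⟩ : MeasurableSet[A] P ∧ MeasurableSet[A] Q := measurableSet_lt_and_lt_neg hy' c
  have hPn := hA.nullMeasurable P hPA
  have hQn := hA.nullMeasurable Q hQA
  have hPQ : Disjoint P Q := by
    refine disjoint_left.2 fun u (h1 : c < y' u) (h2 : y' u < -c) => ?_
    linarith
  have h1 : (lam P).toReal * c ≤ ∫ u in P, |x u| ∂lam := by
    calc (lam P).toReal * c = ∫ u in P, c ∂lam := by simp [measureReal_def]
      _ ≤ ∫ u in P, y u ∂lam := by
          refine integral_mono_ae (integrable_const c) hyi.integrableOn ?_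
          filter_upwards [ae_restrict_mem₀ hPn, ae_restrict_of_ae hyy'] with u hu hu'
          rw [hu']
          exact le_of_lt hu
      _ = ∫ u in P, x u ∂lam := h P hPA
      _ ≤ _ := integral_mono hxi.integrableOn hxi.abs.integrableOn fun u => le_abs_self _
  have h2 : (lam Q).toReal * c ≤ ∫ u in Q, |x u| ∂lam := by
    calc (lam Q).toReal * c = ∫ u in Q, c ∂lam := by simp [measureReal_def]
      _ ≤ ∫ u in Q, -y u ∂lam := by
          refine integral_mono_ae (integrable_const c) hyi.neg.integrableOn ?_
          filter_upwards [ae_restrict_mem₀ hQn, ae_restrict_of_ae hyy'] with u hu hu'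
          rw [hu']
          exact (lt_neg_of_lt_neg hu).le
      _ = ∫ u in Q, -x u ∂lam := by rw [integral_neg, integral_neg, h Q hQA]
      _ ≤ _ := integral_mono hxi.neg.integrableOn hxi.abs.integrableOn fun u => neg_le_abs _
  have h3 : lam {u | c < |y u|} = lam (P ∪ Q) := by
    refine measure_congr (hyy'.mono fun u hu => ?_)
    change (c < |y u|) = (c < y' u ∨ y' u < -c)
    rw [hu, lt_abs, lt_neg]
  have h4 := (lt_rearr_iff (aemeasurable_coe y) ht.1 hc0.le).1 hc
  rw [h3] at h4
  set τ := (lam (P ∪ Q)).toReal with hτ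
  have htτ : t < τ := (ENNReal.ofReal_lt_iff_lt_toReal ht.1.le (measure_ne_top _ _)).1 h4
  have hτ1 : τ ≤ 1 := ENNReal.toReal_mono ENNReal.one_ne_top prob_le_one
  have h5 : τ = (lam P).toReal + (lam Q).toReal := by
    rw [hτ, measure_union₀ hQn hPQ.aedisjoint,
      ENNReal.toReal_add (measure_ne_top _ _) (measure_ne_top _ _)]
  have h6 : τ * c ≤ psi x τ := by
    calc τ * c = (lam P).toReal * c + (lam Q).toReal * c := by rw [h5, add_mul]
      _ ≤ (∫ u in P, |x u| ∂lam) + ∫ u in Q, |x u| ∂lam := add_le_add h1 h2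
      _ = ∫ u in P ∪ Q, |x u| ∂lam :=
          (setIntegral_union₀ hPQ.aedisjoint hQn hxi.abs.integrableOn hxi.abs.integrableOn).symm
      _ ≤ _ := setIntegral_abs_le_psi hxi _
  have hτ0 : 0 < τ := ht.1.trans htτ
  calc c ≤ maximalFn x τ := by rwa [maximalFn, le_inv_mul_iff₀ hτ0]
    _ ≤ _ := maximalFn_antitoneOn hxi ht ⟨hτ0, hτ1⟩ htτ.le

lemma RegularNearZero.averages {f : L1} (hf : f ≠ 0) (h : RegularNearZero f)
    {A : MeasurableSpace ℝ} (hA : IsSigmaSubalgebra A) : Averages A (symIdeal f) := by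
  intro x hx y hy
  rw [mem_symIdeal_iff hf] at hx ⊢
  exact h.dominated_of_le_maximalFn hf hx zero_le_one fun t ht => by
    rw [one_mul]
    exact hy.rearr_le hA ht

/-! ### Admissible operators -/

lemma memLp_one_of_top (z : Lp ℝ ∞ lam) : MemLp z 1 lam := (Lp.memLp z).mono_exponent le_top

/-- The inclusion of `L^∞` into `L¹`. -/
noncomputable def inclTop : Lp ℝ ∞ lam →L[ℝ] L1 :=
  LinearMap.mkContinuous
    { toFun := fun z => (memLp_one_of_top z).toLp z
      map_add' := fun z w => by
        rw [← MemLp.toLp_add]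
        exact MemLp.toLp_congr _ _ (Lp.coeFn_add z w)
      map_smul' := fun c z => by
        rw [RingHom.id_apply, ← MemLp.toLp_const_smul]
        exact MemLp.toLp_congr _ _ (Lp.coeFn_smul c z) } 1 fun z => by
    change ‖(memLp_one_of_top z).toLp z‖ ≤ 1 * ‖z‖
    rw [one_mul, Lp.norm_toLp, Lp.norm_def]
    exact ENNReal.toReal_mono (Lp.memLp z).2.ne
      (eLpNorm_le_eLpNorm_of_exponent_le le_top (Lp.aestronglyMeasurable z))

lemma coeFn_inclTop (z : Lp ℝ ∞ lam) : inclTop z =ᵐ[lam] z := (memLp_one_of_top z).coeFn_toLp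

lemma memLp_top_inclTop (z : Lp ℝ ∞ lam) : MemLp (inclTop z) ∞ lam :=
  (Lp.memLp z).ae_eq (coeFn_inclTop z).symm

lemma inclTop_toLp {x : L1} (hx : MemLp x ∞ lam) : inclTop (hx.toLp x) = x :=
  Lp.ext ((coeFn_inclTop _).trans hx.coeFn_toLp)

lemma inclTop_injective : Function.Injective inclTop := fun z w h =>
  Lp.ext ((coeFn_inclTop z).symm.trans ((Lp.ext_iff.1 h).trans (coeFn_inclTop w)))

/-- By the closed graph theorem an admissible operator is bounded in the uniform norm. -/
lemma IsAdmissible.exists_bound {T : L1 →L[ℝ] L1} (hT : IsAdmissible T) :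
    ∃ C, 0 ≤ C ∧ ∀ (x : L1) (M : ℝ), 0 ≤ M → (∀ᵐ u ∂lam, |x u| ≤ M) →
      ∀ᵐ u ∂lam, |T x u| ≤ C * M := by
  have hT' : ∀ z : Lp ℝ ∞ lam, MemLp (T (inclTop z)) ∞ lam := fun z =>
    hT _ (memLp_top_inclTop z)
  let S : Lp ℝ ∞ lam →ₗ[ℝ] Lp ℝ ∞ lam :=
    { toFun := fun z => (hT' z).toLp _
      map_add' := fun z w => inclTop_injective (by
        refine (inclTop_toLp (hT' (z + w))).trans ?_
        rw [map_add inclTop z w, map_add T, map_add inclTop, inclTop_toLp, inclTop_toLp])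
      map_smul' := fun c z => inclTop_injective (by
        refine (inclTop_toLp (hT' (c • z))).trans ?_
        rw [map_smul inclTop c z, map_smul T, RingHom.id_apply, map_smul inclTop, inclTop_toLp]) }
  have hS : ∀ z, inclTop (S z) = T (inclTop z) := fun z => inclTop_toLp (hT' z)
  have hc : Continuous S := by
    refine S.continuous_of_seq_closed_graph fun u x y hu hy => inclTop_injective ?_
    rw [hS]
    have h1 : Tendsto (fun n => inclTop (S (u n))) atTop (𝓝 (inclTop y)) :=
      (inclTop.continuous.tendsto y).comp hy
    have h2 : Tendsto (fun n => inclTop (S (u n))) atTop (𝓝 (T (inclTop x))) := by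
      simp only [hS]
      exact ((T.comp inclTop).continuous.tendsto x).comp hu
    exact tendsto_nhds_unique h1 h2
  let S' : Lp ℝ ∞ lam →L[ℝ] Lp ℝ ∞ lam := ⟨S, hc⟩
  refine ⟨‖S'‖, norm_nonneg _, fun x M hM hx => ?_⟩
  have hx' : MemLp x ∞ lam := memLp_top_of_bound_ae hx
  have h1 : ‖hx'.toLp x‖ ≤ M := by
    rw [Lp.norm_toLp]
    refine ENNReal.toReal_le_of_le_ofReal hM ?_
    rw [eLpNorm_exponent_top]
    exact eLpNormEssSup_le_of_ae_bound hx
  have h2 : ‖S' (hx'.toLp x)‖ ≤ ‖S'‖ * M := (S'.le_opNorm _).trans (by gcongr)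
  have h3 : T x = inclTop (S' (hx'.toLp x)) := by
    change _ = inclTop (S _)
    rw [hS, inclTop_toLp]
  have h4 := ae_le_eLpNormEssSup (f := S' (hx'.toLp x)) (μ := lam)
  rw [h3]
  filter_upwards [coeFn_inclTop (S' (hx'.toLp x)), h4] with u hu hu'
  rw [hu]
  rw [← eLpNorm_exponent_top] at hu'
  have h5 := ENNReal.toReal_mono (Lp.memLp (S' (hx'.toLp x))).2.ne hu'
  rw [← Lp.norm_def] at h5
  exact le_trans (by simpa using h5) h2

lemma abs_sub_clamp {c : ℝ} (hc : 0 ≤ c) (a : ℝ) :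
    |a - max (-c) (min c a)| = max (|a| - c) 0 := by
  rcases le_total a (-c) with h | h
  · have h0 : a ≤ 0 := by linarith
    rw [min_eq_right (by linarith), max_eq_left h, abs_of_nonpos (by linarith),
      abs_of_nonpos h0, max_eq_left (by linarith)]
    ring
  rcases le_total a c with h' | h'
  · rw [min_eq_right h', max_eq_right h, sub_self, abs_zero,
      max_eq_right (by linarith [abs_le.2 ⟨h, h'⟩])]
  · rw [min_eq_left h', max_eq_right (by linarith), abs_of_nonneg (by linarith),
      abs_of_nonneg (by linarith), max_eq_left (by linarith)]

/-- Split `x` into its truncation b at height c = x*(t) and the rest. The L^∞ bound controls Tb by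
Cc, the L¹ bound and Chebyshev's inequality control (T(x - b))*(t) by ‖T‖‖x - b‖/t, and ‖x - b‖ + tc
is exactly ψ_x(t). -/
lemma IsAdmissible.exists_rearr_le {T : L1 →L[ℝ] L1} (hT : IsAdmissible T) :
    ∃ C, 0 ≤ C ∧ ∀ (x : L1), ∀ t ∈ Ioc (0 : ℝ) 1, rearr (T x) t ≤ C * maximalFn x t := by
  obtain ⟨C, hC, hb⟩ := hT.exists_bound
  refine ⟨max C ‖T‖, le_max_of_le_left hC, fun x t ht => ?_⟩
  have hxi := L1.integrable_coeFn x
  have hxm := (Lp.stronglyMeasurable x).measurable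
  set c := rearr x t with hc
  have hc0 : 0 ≤ c := rearr_nonneg _ _
  have hbd : ∀ u, |max (-c) (min c (x u))| ≤ c := fun u =>
    abs_le.2 ⟨le_max_left _ _, max_le (by linarith) (min_le_left _ _)⟩
  have hi : Integrable (fun u => max (-c) (min c (x u))) lam :=
    Integrable.mono' (integrable_const c)
      (measurable_const.max (measurable_const.min hxm)).aestronglyMeasurable (ae_of_all _ hbd)
  set b : L1 := hi.toL1 _ with hbdef
  have hbc : b =ᵐ[lam] fun u => max (-c) (min c (x u)) := hi.coeFn_toL1
  have hTb := hb b c hc0 (hbc.mono fun u hu => by rw [hu]; exact hbd u)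
  have hnorm : ‖x - b‖ = ∫ u, max (|x u| - c) 0 ∂lam := by
    rw [L1.norm_eq_integral_norm]
    refine integral_congr_ae ?_
    filter_upwards [Lp.coeFn_sub x b, hbc] with u h1 h2
    rw [h1, Pi.sub_apply, h2, Real.norm_eq_abs, abs_sub_clamp hc0]
  have hsplit : ∀ᵐ u ∂lam, |T x u| ≤ |T (x - b) u| + C * c := by
    have h1 : T x = T (x - b) + T b := by rw [← map_add, sub_add_cancel]
    filter_upwards [hTb, Lp.coeFn_add (T (x - b)) (T b)] with u h2 h3
    rw [h1, h3, Pi.add_apply]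
    exact (abs_add_le _ _).trans (add_le_add le_rfl h2)
  have h1 := rearr_le_rearr_add (aemeasurable_coe _) (mul_nonneg hC hc0) hsplit ht.1
  have h2 := rearr_le_psi_one_div (L1.integrable_coeFn (T (x - b))) ht.1 ht.2
  have h3 : ∫ u, |T (x - b) u| ∂lam ≤ ‖T‖ * ‖x - b‖ :=
    (L1.norm_eq_integral_norm (T (x - b))).symm.trans_le (T.le_opNorm _)
  have h4 : psi x t = ‖x - b‖ + t * c := by rw [hnorm, psi_eq_excess hxi ht.1 ht.2]
  calc rearr (T x) t ≤ ‖T‖ * ‖x - b‖ / t + C * c :=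
        h1.trans (add_le_add (h2.trans (div_le_div_of_nonneg_right h3 ht.1.le)) le_rfl)
    _ ≤ max C ‖T‖ * ‖x - b‖ / t + max C ‖T‖ * c := by
        gcongr
        · exact ht.1.le
        · exact le_max_right _ _
        · exact le_max_left _ _
    _ = max C ‖T‖ * maximalFn x t := by
        rw [maximalFn, h4]
        field_simp [ht.1.ne']

lemma RegularNearZero.isMajorantIdeal {f : L1} (hf : f ≠ 0) (h : RegularNearZero f) :
    IsMajorantIdeal (symIdeal f) where
  toIsOrderIdeal := by
    rw [symIdeal_eq hf]
    exact (isSymmetricIdeal_dominatedSubmodule hf).toIsOrderIdeal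
  interpolation T hT x hx := by
    rw [mem_symIdeal_iff hf] at hx ⊢
    obtain ⟨C, hC, hT⟩ := hT.exists_rearr_le
    exact h.dominated_of_le_maximalFn hf hx hC (hT x)

/-! ### Majorant ideals are symmetric -/

/-- The block {κ = n} contributes at most a_n λ{κ = n} times the integral of |g| over `A n`, and the
sets `A n` are disjoint. This is the L¹ bound for block operators. -/
lemma lintegral_block_le {A : ℕ → Set ℝ} (hA : ∀ n, MeasurableSet (A n))
    (hd : Pairwise (Function.onFun Disjoint A)) {κ : ℝ → ℕ} (hκ : Measurable κ) {a : ℕ → ℝ}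
    (ha : ∀ n, 0 ≤ a n) {C : ℝ} (h : ∀ n, a n * lam.real (κ ⁻¹' {n}) ≤ C) (g : ℝ → ℝ) :
    ∫⁻ u, ‖a (κ u) * ∫ v in A (κ u), g v ∂lam‖ₑ ∂lam ≤ ENNReal.ofReal C * ∫⁻ v, ‖g v‖ₑ ∂lam := by
  have hF : Measurable fun n => ENNReal.ofReal (a n) * ∫⁻ v in A n, ‖g v‖ₑ ∂lam :=
    Measurable.of_discrete
  calc ∫⁻ u, ‖a (κ u) * ∫ v in A (κ u), g v ∂lam‖ₑ ∂lam
      ≤ ∫⁻ u, (fun n => ENNReal.ofReal (a n) * ∫⁻ v in A n, ‖g v‖ₑ ∂lam) (κ u) ∂lam := by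
        refine lintegral_mono fun u => ?_
        rw [enorm_mul, Real.enorm_of_nonneg (ha _)]
        exact mul_le_mul_right (enorm_integral_le_lintegral_enorm _) _
    _ = ∑' n, (ENNReal.ofReal (a n) * ∫⁻ v in A n, ‖g v‖ₑ ∂lam) * lam (κ ⁻¹' {n}) := by
        rw [← lintegral_map hF hκ, lintegral_countable']
        simp_rw [Measure.map_apply hκ (measurableSet_singleton _)]
    _ ≤ ∑' n, ENNReal.ofReal C * ∫⁻ v in A n, ‖g v‖ₑ ∂lam := by
        refine ENNReal.tsum_le_tsum fun n => ?_
        rw [mul_right_comm]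
        refine mul_le_mul_left ?_ _
        rw [← ofReal_measureReal, ← ENNReal.ofReal_mul (ha n)]
        exact ENNReal.ofReal_le_ofReal (h n)
    _ = ENNReal.ofReal C * ∫⁻ v in ⋃ n, A n, ‖g v‖ₑ ∂lam := by
        rw [ENNReal.tsum_mul_left, lintegral_iUnion hA hd]
    _ ≤ _ := by
        gcongr
        exact Measure.restrict_le_self

/-- Operators that replace a function on the block `κ = n` by a multiple of its integral over
`A n` are admissible. -/
lemma exists_blockOperator {A : ℕ → Set ℝ} (hA : ∀ n, MeasurableSet (A n))
    (hd : Pairwise (Function.onFun Disjoint A)) {κ : ℝ → ℕ} (hκ : Measurable κ) {a : ℕ → ℝ}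
    (ha : ∀ n, 0 ≤ a n) {C : ℝ} (h : ∀ n, a n * lam.real (κ ⁻¹' {n}) ≤ C)
    (h' : ∀ n, a n * lam.real (A n) ≤ C) :
    ∃ T : L1 →L[ℝ] L1, IsAdmissible T ∧
      ∀ g : L1, T g =ᵐ[lam] fun u => a (κ u) * ∫ v in A (κ u), g v ∂lam := by
  have hC : 0 ≤ C := (mul_nonneg (ha 0) measureReal_nonneg).trans (h 0)
  have hle := lintegral_block_le hA hd hκ ha h
  have hi : ∀ g : L1, Integrable (fun u => a (κ u) * ∫ v in A (κ u), g v ∂lam) lam := by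
    intro g
    have hm : Measurable fun n => a n * ∫ v in A n, g v ∂lam := Measurable.of_discrete
    refine ⟨(hm.comp hκ).aestronglyMeasurable, ?_⟩
    rw [hasFiniteIntegral_iff_enorm]
    exact (hle g).trans_lt (ENNReal.mul_lt_top ENNReal.ofReal_lt_top
      (L1.integrable_coeFn g).2)
  let T₀ : L1 →ₗ[ℝ] L1 :=
    { toFun := fun g => (hi g).toL1 _
      map_add' := fun g k => by
        rw [← Integrable.toL1_add]
        refine (Integrable.toL1_eq_toL1_iff _ _ _ _).2 (ae_of_all _ fun u => ?_)
        change _ = a (κ u) * _ + a (κ u) * _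
        rw [← mul_add, ← integral_add (L1.integrable_coeFn g).integrableOn
          (L1.integrable_coeFn k).integrableOn]
        exact congrArg _ (integral_congr_ae (ae_restrict_of_ae (Lp.coeFn_add g k)))
      map_smul' := fun c g => by
        rw [RingHom.id_apply, ← Integrable.toL1_smul]
        refine (Integrable.toL1_eq_toL1_iff _ _ _ _).2 (ae_of_all _ fun u => ?_)
        change _ = c * (a (κ u) * _)
        rw [mul_left_comm, ← integral_const_mul]
        exact congrArg _ (integral_congr_ae (ae_restrict_of_ae (Lp.coeFn_smul c g))) }
  let T : L1 →L[ℝ] L1 := T₀.mkContinuous C fun g => by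
    change ‖(hi g).toL1 _‖ ≤ _
    rw [Integrable.norm_toL1_eq_lintegral_enorm, L1.norm_def, ← ENNReal.toReal_ofReal hC,
      ← ENNReal.toReal_mul]
    exact ENNReal.toReal_mono (ENNReal.mul_ne_top ENNReal.ofReal_ne_top
      (L1.integrable_coeFn g).2.ne) (hle g)
  have hT : ∀ g : L1, T g =ᵐ[lam] fun u => a (κ u) * ∫ v in A (κ u), g v ∂lam :=
    fun g => (hi g).coeFn_toL1
  refine ⟨T, fun x hx => ?_, hT⟩
  obtain ⟨M, hM, hx⟩ := exists_bound_of_memLp hx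
  refine memLp_top_of_bound_ae (M := C * M) ((hT x).mono fun u hu => ?_)
  rw [hu, abs_mul, abs_of_nonneg (ha _)]
  have h1 : |∫ v in A (κ u), x v ∂lam| ≤ M * lam.real (A (κ u)) :=
    norm_setIntegral_le_of_norm_le_const_ae' (s := A (κ u)) (f := x) (measure_lt_top _ _) (hx.mono fun v hv _ => hv)
  calc a (κ u) * |∫ v in A (κ u), x v ∂lam| ≤ a (κ u) * (M * lam.real (A (κ u))) :=
        mul_le_mul_of_nonneg_left h1 (ha _)
    _ = a (κ u) * lam.real (A (κ u)) * M := by ring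
    _ ≤ C * M := mul_le_mul_of_nonneg_right (h' _) hM

/-- An increasing family in `r` of sets between `{|x| > x*(t)}` and `{|x| ≥ x*(t)}`. -/
def levelSet (x : L1) (t r : ℝ) : Set ℝ :=
  {u | rearr x t < |x u|} ∪ ({u | |x u| = rearr x t} ∩ Iic r)

lemma measurableSet_levelSet (x : L1) (t r : ℝ) : MeasurableSet (levelSet x t r) := by
  have hx : Measurable fun u => |x u| := (Lp.stronglyMeasurable x).measurable.norm
  exact (measurableSet_lt measurable_const hx).union
    ((measurableSet_eq_fun hx measurable_const).inter measurableSet_Iic)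

lemma levelSet_mono (x : L1) (t : ℝ) {r s : ℝ} (h : r ≤ s) : levelSet x t r ⊆ levelSet x t s :=
  union_subset_union_right _ (inter_subset_inter_right _ (Iic_subset_Iic.2 h))

lemma le_abs_of_mem_levelSet {x : L1} {t r u : ℝ} (hu : u ∈ levelSet x t r) :
    rearr x t ≤ |x u| := by
  rcases hu with hu | hu
  · exact le_of_lt hu
  · exact hu.1.symm.le

/-- The tie set {|x| = x*(t)} may have positive measure. The cutoff r admits it gradually: the
measure is 1-Lipschitz in r, at most t for r = 0 and at least t for r = 1. -/
lemma exists_levelSet (x : L1) {t : ℝ} (ht : t ∈ Ioc (0 : ℝ) 1) :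
    ∃ r, lam.real (levelSet x t r) = t := by
  have hxm := aemeasurable_coe x
  have hL : LipschitzWith 1 fun r => lam.real (levelSet x t r) := by
    refine LipschitzWith.of_le_add fun r s => ?_
    rcases le_or_gt r s with h | h
    · exact (measureReal_mono (levelSet_mono x t h)).trans (le_add_of_nonneg_right dist_nonneg)
    · have hsub : levelSet x t r ⊆ levelSet x t s ∪ Ioc s r := by
        rintro u (hu | hu)
        · exact Or.inl (Or.inl hu)
        · rcases le_or_gt u s with hus | hus
          · exact Or.inl (Or.inr ⟨hu.1, hus⟩)
          · exact Or.inr ⟨hus, hu.2⟩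
      have h1 : lam.real (Ioc s r) ≤ r - s := by
        refine ENNReal.toReal_le_of_le_ofReal (by linarith) ?_
        rw [← Real.volume_Ioc]
        exact Measure.restrict_apply_le _ _
      calc lam.real (levelSet x t r) ≤ lam.real (levelSet x t s) + lam.real (Ioc s r) :=
            (measureReal_mono hsub).trans (measureReal_union_le _ _)
        _ ≤ lam.real (levelSet x t s) + dist r s := by
            rw [Real.dist_eq, abs_of_pos (by linarith)]
            linarith
  refine mem_range_of_exists_le_of_exists_ge hL.continuous ⟨0, ?_⟩ ⟨1, ?_⟩
  · refine ENNReal.toReal_le_of_le_ofReal ht.1.le ?_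
    refine (measure_mono_ae ?_).trans (measure_rearr_lt hxm ht.1)
    filter_upwards [ae_lam_mem] with u hu hu'
    rcases hu' with hu' | hu'
    · exact hu'
    · exact absurd hu'.2 (not_le.2 hu.1)
  · have h1 : lam {u | rearr x t ≤ |x u|} = lam {u | rearr x t ≤ rearr x u} :=
      (identDistrib_rearr hxm).measure_mem_eq (s := Ici (rearr x t)) measurableSet_Ici
    have h2 : ENNReal.ofReal t ≤ lam {u | rearr x t ≤ rearr x u} := by
      rw [← lam_Ioc ht.2]
      exact measure_mono fun u hu => rearr_antitone hxm hu.1 hu.2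
    have h3 : ENNReal.ofReal t ≤ lam (levelSet x t 1) := by
      refine (h2.trans_eq h1.symm).trans (measure_mono_ae ?_)
      filter_upwards [ae_lam_mem] with u hu hu'
      rcases (show rearr x t ≤ |x u| from hu').eq_or_lt with h | h
      · exact Or.inr ⟨h.symm, hu.2⟩
      · exact Or.inl h
    exact (ENNReal.ofReal_le_iff_le_toReal (measure_ne_top _ _)).1 h3

lemma half_pow_mem (n : ℕ) : (1 / 2 : ℝ) ^ n ∈ Ioc (0 : ℝ) 1 :=
  ⟨by positivity, pow_le_one₀ (by norm_num) (by norm_num)⟩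

lemma exists_dyadic_levelSets (x : L1) : ∃ A : ℕ → Set ℝ, (∀ n, MeasurableSet (A n)) ∧
    Pairwise (Function.onFun Disjoint A) ∧ (∀ n, lam.real (A n) = (1 / 2) ^ (n + 1)) ∧
    ∀ n, ∀ u ∈ A n, rearr x ((1 / 2) ^ n) ≤ |x u| := by
  choose r hr using fun n : ℕ => exists_levelSet x (half_pow_mem n)
  set X : ℕ → Set ℝ := fun n => levelSet x ((1 / 2) ^ n) (r n) with hX
  have hm : ∀ n, MeasurableSet (X n) := fun n => measurableSet_levelSet _ _ _
  have hanti : Antitone X := by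
    refine antitone_nat_of_succ_le fun n => ?_
    have hlt : (1 / 2 : ℝ) ^ (n + 1) < (1 / 2) ^ n :=
      pow_lt_pow_right_of_lt_one₀ (by norm_num) (by norm_num) n.lt_succ_self
    -- If consecutive levels differ, nesting is immediate. If they agree, the sets are compared by
    -- their cutoffs, and the wrong order would contradict their measures.
    rcases (rearr_antitone (aemeasurable_coe x) (half_pow_mem (n + 1)).1 hlt.le).eq_or_lt
      with h | h
    · rcases le_or_gt (r (n + 1)) (r n) with h' | h'
      · simp only [hX, levelSet, h]
        exact levelSet_mono x ((1 / 2) ^ (n + 1)) h' |>.trans_eq (by simp only [levelSet])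
      · have hsub : X n ⊆ X (n + 1) := by
          have h1 := levelSet_mono x ((1 / 2) ^ n) h'.le
          simp only [levelSet] at h1
          simp only [hX, levelSet, ← h]
          exact h1
        have := measureReal_mono (μ := lam) hsub
        rw [hr n, hr (n + 1)] at this
        exact absurd this (not_le.2 hlt)
    · exact fun u hu => Or.inl (h.trans_le (le_abs_of_mem_levelSet hu))
  refine ⟨fun n => X n \ X (n + 1), fun n => (hm n).diff (hm _), ?_, fun n => ?_,
    fun n u hu => le_abs_of_mem_levelSet hu.1⟩
  · refine (pairwise_disjoint_on _).2 fun m n hmn => disjoint_left.2 fun u hu hu' => ?_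
    exact hu.2 (hanti (Nat.succ_le_of_lt hmn) hu'.1)
  · rw [measureReal_sdiff (hanti n.le_succ) (hm _), hr n, hr (n + 1), pow_succ]
    ring

/-- An admissible T with T|x| ≥ |y| is built from dyadic blocks. On {κ = n} almost everywhere |y| ≤
y*(2⁻ⁿ) ≤ x*(2⁻ⁿ), which is at most the mean of |x| over a set `A n` of measure 2⁻ⁿ⁻¹. -/
lemma IsMajorantIdeal.isSymmetricIdeal {X : Submodule ℝ L1} (hX : IsMajorantIdeal X) :
    IsSymmetricIdeal X where
  toIsOrderIdeal := hX.toIsOrderIdeal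
  symm x hx y hyx := by
    classical
    have hym : Measurable fun u => |y u| := (Lp.stronglyMeasurable y).measurable.norm
    obtain ⟨A, hA, hd, hAm, hAx⟩ := exists_dyadic_levelSets x
    set c : ℕ → ℝ := fun n => rearr y ((1 / 2) ^ n) with hc
    -- The second alternative only makes κ defined everywhere; it holds on a null set, since λ{|y| >
    -- c_k} ≤ 2⁻ᵏ.
    set p : ℝ → ℕ → Prop := fun u n => |y u| ≤ c n ∨ ∀ k, c k < |y u| with hp
    have hpe : ∀ u, ∃ n, p u n := fun u => by
      by_cases h : ∃ n, |y u| ≤ c n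
      · exact ⟨h.choose, Or.inl h.choose_spec⟩
      · push Not at h
        exact ⟨0, Or.inr h⟩
    have hpm : ∀ n, MeasurableSet {u | p u n} := fun n => by
      refine (measurableSet_le hym measurable_const).union ?_
      have : {u | ∀ k, c k < |y u|} = ⋂ k, {u | c k < |y u|} := by
        ext
        simp
      change MeasurableSet {u | ∀ k, c k < |y u|}
      rw [this]
      exact MeasurableSet.iInter fun k => measurableSet_lt measurable_const hym
    set κ : ℝ → ℕ := fun u => Nat.find (hpe u) with hκ
    have hκm : Measurable κ := measurable_find hpe hpm
    have hlevel : ∀ k, lam.real {u | c k < |y u|} ≤ (1 / 2) ^ k := fun k =>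
      ENNReal.toReal_le_of_le_ofReal (half_pow_mem k).1.le
        (measure_rearr_lt (aemeasurable_coe y) (half_pow_mem k).1)
    -- By minimality κ = n + 1 forces |y| > y*(2⁻ⁿ), a set of measure at most 2⁻ⁿ. Against the
    -- weight 2ⁿ⁺² this gives 4.
    have hκ_le : ∀ n, (2 : ℝ) ^ (n + 1) * lam.real (κ ⁻¹' {n}) ≤ 4 := fun n => by
      rcases n with _ | n
      · have : lam.real (κ ⁻¹' {0}) ≤ 1 := measureReal_le_one
        rw [zero_add, pow_one]
        linarith
      · have hsub : κ ⁻¹' {n + 1} ⊆ {u | c n < |y u|} := fun u hu => by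
          have h1 : κ u = n + 1 := hu
          have h2 : ¬ p u n := Nat.find_min (hpe u) (by
            change n < κ u
            omega)
          exact not_le.1 fun h => h2 (Or.inl h)
        have h1 := (measureReal_mono hsub).trans (hlevel n)
        calc (2 : ℝ) ^ (n + 1 + 1) * lam.real (κ ⁻¹' {n + 1})
            ≤ 2 ^ (n + 1 + 1) * (1 / 2) ^ n := by gcongr
          _ = 4 * (2 * (1 / 2)) ^ n := by
              rw [mul_pow]
              ring
          _ = 4 := by norm_num
    have hA_le : ∀ n, (2 : ℝ) ^ (n + 1) * lam.real (A n) = 1 := fun n => by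
      rw [hAm, ← mul_pow]
      norm_num
    obtain ⟨T, hT, hTe⟩ := exists_blockOperator hA hd hκm (a := fun n => 2 ^ (n + 1))
      (fun n => by positivity) hκ_le fun n => (hA_le n).trans_le (by norm_num)
    have hx' : |x| ∈ X := hX.solid x hx _ (abs_abs x).le
    refine hX.solid _ (hX.interpolation T hT _ hx') y ((abs_le_abs_iff_ae _ _).2 ?_)
    have hnull : ∀ᵐ u ∂lam, ∃ k, |y u| ≤ c k := by
      have h0 : lam.real {u | ∀ k, c k < |y u|} = 0 := by
        refine le_antisymm ?_ measureReal_nonneg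
        refine ge_of_tendsto' (tendsto_pow_atTop_nhds_zero_of_lt_one
          (by norm_num : (0 : ℝ) ≤ 1 / 2) (by norm_num)) fun k => ?_
        exact (measureReal_mono fun u (hu : ∀ k, c k < |y u|) => hu k).trans (hlevel k)
      have h1 := (measureReal_eq_zero_iff).1 h0
      have h2 : ∀ᵐ u ∂lam, ¬ ∀ k, c k < |y u| := measure_eq_zero_iff_ae_notMem.1 h1
      filter_upwards [h2] with u hu
      push Not at hu
      exact hu
    filter_upwards [hTe |x|, hnull] with u hu hu'
    rw [hu]
    have h1 : |y u| ≤ c (κ u) := by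
      rcases Nat.find_spec (hpe u) with h | h
      · exact h
      · obtain ⟨k, hk⟩ := hu'
        exact absurd (h k) (not_lt.2 hk)
    set n := κ u
    have hxi : Integrable (|x| : L1) lam := L1.integrable_coeFn _
    have h2 : lam.real (A n) * rearr x ((1 / 2) ^ n) ≤ ∫ v in A n, (|x| : L1) v ∂lam := by
      calc lam.real (A n) * rearr x ((1 / 2) ^ n) = ∫ v in A n, rearr x ((1 / 2) ^ n) ∂lam := by
            simp
        _ ≤ _ := by
          refine integral_mono_ae (integrable_const _) hxi.integrableOn ?_
          filter_upwards [ae_restrict_mem (hA n), ae_restrict_of_ae (Lp.coeFn_abs x)] with v h3 h4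
          rw [h4]
          exact hAx n v h3
    calc |y u| ≤ rearr x ((1 / 2) ^ n) := h1.trans (hyx _ (half_pow_mem n))
      _ = 2 ^ (n + 1) * (lam.real (A n) * rearr x ((1 / 2) ^ n)) := by
          rw [← mul_assoc, hA_le, one_mul]
      _ ≤ 2 ^ (n + 1) * ∫ v in A n, (|x| : L1) v ∂lam := by gcongr
      _ ≤ _ := le_abs_self _

lemma symIdeal_le_majIdeal (f : L1) : symIdeal f ≤ majIdeal f :=
  sInf_le_sInf fun _ hX => ⟨hX.1.isSymmetricIdeal, hX.2⟩

lemma RegularNearZero.symIdeal_eq_majIdeal {f : L1} (hf : f ≠ 0) (h : RegularNearZero f) :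
    symIdeal f = majIdeal f :=
  le_antisymm (symIdeal_le_majIdeal f) (sInf_le ⟨h.isMajorantIdeal hf,
    (mem_symIdeal_iff hf).2 (dominated_self f)⟩)

lemma map_mem_majIdeal {f x : L1} {T : L1 →L[ℝ] L1} (hT : IsAdmissible T) (hx : x ∈ majIdeal f) :
    T x ∈ majIdeal f :=
  (Submodule.mem_sInf).2 fun X hX => hX.1.interpolation T hT x ((Submodule.mem_sInf).1 hx X hX)

/-! ### Averaging over countable partitions -/

lemma comap_le_borel {κ : ℝ → ℕ} (hκ : Measurable κ) :
    MeasurableSpace.comap κ ⊤ ≤ Real.measurableSpace := hκ.comap_le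

lemma isAdmissible_condExpL1CLM {κ : ℝ → ℕ} (hκ : Measurable κ) :
    IsAdmissible (condExpL1CLM ℝ (comap_le_borel hκ) lam) := by
  intro x hx
  obtain ⟨M, hM, h⟩ := exists_bound_of_memLp hx
  have h1 := condExp_ae_eq_condExpL1CLM (comap_le_borel hκ) (L1.integrable_coeFn x)
  rw [Integrable.toL1_coeFn] at h1
  have h2 := ae_bdd_abs_condExp_of_ae_bdd_abs (m := MeasurableSpace.comap κ ⊤) h
  refine memLp_top_of_bound_ae (M := M) ?_
  filter_upwards [h1, h2] with u hu hu'
  rwa [← hu]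

lemma isSigmaSubalgebra_comap {κ : ℝ → ℕ} (hκ : Measurable κ) :
    IsSigmaSubalgebra (eventuallyMeasurableSpace (MeasurableSpace.comap κ ⊤) (ae lam)) where
  nullMeasurable s := by
    rintro ⟨s', hs', h⟩
    exact ⟨s', comap_le_borel hκ s' hs', h⟩
  null_mem s hs := ⟨∅, MeasurableSpace.measurableSet_empty _, ae_eq_empty.2 hs⟩

lemma isCondExp_condExpL1CLM {κ : ℝ → ℕ} (hκ : Measurable κ) (x : L1) :
    IsCondExp (eventuallyMeasurableSpace (MeasurableSpace.comap κ ⊤) (ae lam)) x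
      (condExpL1CLM ℝ (comap_le_borel hκ) lam x) := by
  refine ⟨(aestronglyMeasurable_condExpL1CLM x).mono le_eventuallyMeasurableSpace, ?_⟩
  rintro s ⟨s', hs', h⟩
  rw [setIntegral_congr_set h, setIntegral_congr_set h, setIntegral_condExpL1CLM x hs']

/-- The conditional expectation over the partition `κ` is the mean value on each block. -/
lemma condExpL1CLM_ae_eq_average {κ : ℝ → ℕ} (hκ : Measurable κ) (x : L1) :
    ∀ᵐ u ∂lam, lam.real (κ ⁻¹' {κ u}) * condExpL1CLM ℝ (comap_le_borel hκ) lam x u =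
      ∫ v in κ ⁻¹' {κ u}, x v ∂lam := by
  obtain ⟨y, hy, hxy⟩ := aestronglyMeasurable_condExpL1CLM (hm := comap_le_borel hκ) (μ := lam) x
  have hy' := hy.measurable
  filter_upwards [hxy] with u hu
  have hmn : MeasurableSet[MeasurableSpace.comap κ ⊤] (κ ⁻¹' {κ u}) :=
    ⟨{κ u}, MeasurableSpace.measurableSet_top, rfl⟩
  rw [← setIntegral_condExpL1CLM (hm := comap_le_borel hκ) x hmn, hu]
  -- A function measurable for the σ-algebra generated by κ is constant on the fibres of κ.
  have hc : ∀ v ∈ κ ⁻¹' {κ u}, y v = y u := fun v hv => by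
    obtain ⟨S, -, hS⟩ := hy' (measurableSet_singleton (y u))
    have h1 : κ u ∈ S := by
      have : u ∈ κ ⁻¹' S := by
        rw [hS]
        rfl
      exact this
    have h2 : v ∈ κ ⁻¹' S := by
      rw [mem_preimage, show κ v = κ u from hv]
      exact h1
    rw [hS] at h2
    exact h2
  have hae : ∀ᵐ v ∂lam.restrict (κ ⁻¹' {κ u}),
      condExpL1CLM ℝ (comap_le_borel hκ) lam x v = y u := by
    filter_upwards [ae_restrict_mem (hκ (measurableSet_singleton (κ u))),
      ae_restrict_of_ae hxy] with v hv hv'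
    rw [hv', hc v hv]
  rw [integral_congr_ae hae]
  simp

/-- Failure of weak regularity with constant n + 1 supplies bad points arbitrarily close to zero;
each is taken so small that both t and ψ are at least halved. -/
lemma exists_steep_sequence {f : L1} (hf : f ≠ 0) (h : ¬ WeaklyRegular f) :
    ∃ t : ℕ → ℝ, t 0 = 1 ∧ ∀ n, t n ∈ Ioc (0 : ℝ) 1 ∧ t (n + 1) ≤ t n / 2 ∧
      psi f (t (n + 1)) ≤ psi f (t n) / 2 ∧
      (n + 1) * rearr f (t (n + 1) / (n + 1)) < maximalFn f (t (n + 1)) := by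
  have hfi := L1.integrable_coeFn f
  have hstep : ∀ n : ℕ, ∀ v ∈ Ioc (0 : ℝ) 1, ∃ w ∈ Ioc (0 : ℝ) (v / 2), psi f w ≤ psi f v / 2 ∧
      ((n : ℝ) + 1) * rearr f (w / (n + 1)) < maximalFn f w := by
    intro n v hv
    obtain ⟨δ, hδ, hψ⟩ := exists_psi_le hfi (half_pos (psi_pos hf hv.1 hv.2))
    have h1 : 0 < min δ (v / 2) := lt_min hδ.1 (half_pos hv.1)
    by_contra! hc
    refine h ⟨(n : ℝ) + 1, by simp, min δ (v / 2), h1, fun w hw => ?_⟩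
    exact hc w ⟨hw.1, hw.2.le.trans (min_le_right _ _)⟩
      (hψ w ⟨hw.1.le, hw.2.le.trans (min_le_left _ _)⟩)
  choose! w hw hψ hlt using hstep
  let t : ℕ → ℝ := fun n => Nat.rec 1 (fun n v => w n v) n
  have ht : ∀ n, t n ∈ Ioc (0 : ℝ) 1 := by
    intro n
    induction n with
    | zero => exact ⟨one_pos, le_rfl⟩
    | succ n ih => exact ⟨(hw n _ ih).1, (hw n _ ih).2.trans (by linarith [ih.1, ih.2])⟩
  exact ⟨t, rfl, fun n => ⟨ht n, (hw n _ (ht n)).2, hψ n _ (ht n), hlt n _ (ht n)⟩⟩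

lemma exists_partition {t : ℕ → ℝ} (h0 : t 0 = 1) (ht : ∀ n, t n ∈ Ioc (0 : ℝ) 1)
    (hhalf : ∀ n, t (n + 1) ≤ t n / 2) :
    ∃ κ : ℝ → ℕ, Measurable κ ∧ ∀ u ∈ Ioc (0 : ℝ) 1, ∀ n, κ u = n ↔ u ∈ Ioc (t (n + 1)) (t n) := by
  classical
  have hanti : Antitone t := antitone_nat_of_succ_le fun n => by
    linarith [hhalf n, (ht n).1]
  have hpow : ∀ n, t n ≤ (1 / 2) ^ n := by
    intro n
    induction n with
    | zero => simp [h0]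
    | succ n ih =>
      rw [pow_succ]
      linarith [hhalf n]
  -- The alternative u ≤ 0 is a default making `Nat.find` total; it is irrelevant on (0, 1].
  have hex : ∀ u : ℝ, ∃ n, t (n + 1) < u ∨ u ≤ 0 := fun u => by
    rcases le_or_gt u 0 with hu | hu
    · exact ⟨0, Or.inr hu⟩
    · obtain ⟨n, hn⟩ := exists_pow_lt_of_lt_one hu (by norm_num : (1 / 2 : ℝ) < 1)
      exact ⟨n, Or.inl (((hanti n.le_succ).trans (hpow n)).trans_lt hn)⟩
  refine ⟨fun u => Nat.find (hex u), measurable_find hex fun n =>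
    measurableSet_Ioi.union measurableSet_Iic, fun u hu n => ?_⟩
  have hu0 : ¬ u ≤ 0 := not_le.2 hu.1
  rw [Nat.find_eq_iff]
  simp only [hu0, or_false, not_lt, mem_Ioc]
  refine and_congr_right fun _ => ⟨fun h => ?_, fun h m hm => h.trans (hanti hm)⟩
  rcases n with _ | n
  · rw [h0]
    exact hu.2
  · exact h n n.lt_succ_self

/-- If `f` is not regular, some countable partition does not average the symmetric ideal. -/
lemma exists_not_dominated_condExp {f : L1} (hf : f ≠ 0) (h : ¬ WeaklyRegular f) :
    ∃ (κ : ℝ → ℕ) (hκ : Measurable κ),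
      ¬ Dominated f (condExpL1CLM ℝ (comap_le_borel hκ) lam (rearrL f)) := by
  have hfi := L1.integrable_coeFn f
  obtain ⟨t, h0, ht⟩ := exists_steep_sequence hf h
  have ht1 := fun n => (ht n).1
  have hhalf := fun n => (ht n).2.1
  obtain ⟨κ, hκ, hκt⟩ := exists_partition h0 ht1 hhalf
  have hanti : Antitone t := antitone_nat_of_succ_le fun n => by
    linarith [hhalf n, (ht1 n).1]
  refine ⟨κ, hκ, ?_⟩
  set y := condExpL1CLM ℝ (comap_le_borel hκ) lam (rearrL f) with hy
  have hblock : ∀ n, (κ ⁻¹' {n} : Set ℝ) =ᵐ[lam] Ioc (t (n + 1)) (t n) := fun n => by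
    filter_upwards [ae_lam_mem] with u hu
    exact propext (hκt u hu n)
  have hsub : ∀ n, Ioc (t (n + 1)) (t n) ⊆ Ioc (0 : ℝ) 1 := fun n =>
    Ioc_subset_Ioc (ht1 _).1.le (ht1 n).2
  -- The mean of f* over the block is (ψ(t_n) - ψ(t_{n+1}))/(t_n - t_{n+1}). Halving of ψ keeps the
  -- numerator at least ψ(t_n)/2, and the denominator is at most t_n.
  have hlow : ∀ᵐ u ∂lam, maximalFn f (t (κ u)) / 2 ≤ y u := by
    filter_upwards [condExpL1CLM_ae_eq_average hκ (rearrL f)] with u hu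
    set n := κ u
    have h1 : lam.real (κ ⁻¹' {n}) = t n - t (n + 1) := by
      rw [measureReal_def, measure_congr (hblock n), lam_apply, inter_eq_left.2 (hsub n),
        Real.volume_Ioc, ENNReal.toReal_ofReal]
      linarith [hanti n.le_succ]
    have h2 : ∫ v in κ ⁻¹' {n}, rearrL f v ∂lam = psi f (t n) - psi f (t (n + 1)) := by
      rw [setIntegral_congr_set (hblock n),
        integral_congr_ae (ae_restrict_of_ae (coeFn_rearrL f)),
        Measure.restrict_restrict measurableSet_Ioc, inter_eq_left.2 (hsub n),
        ← psi_add_integral hfi (ht1 (n + 1)).1.le (hanti n.le_succ) (ht1 n).2,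
        add_sub_cancel_left]
    rw [h1, h2] at hu
    have h3 := (ht n).2.2.1
    have h4 : 0 < t n - t (n + 1) := by linarith [hhalf n, (ht1 n).1]
    have h5 : 0 ≤ maximalFn f (t n) := maximalFn_nonneg _ (ht1 n).1.le
    have h6 := mul_maximalFn f (ht1 n).1
    have h7 := mul_nonneg (ht1 (n + 1)).1.le h5
    refine le_of_mul_le_mul_left ?_ h4
    rw [hu]
    linarith
  rintro ⟨s, hs, hdom⟩
  -- Large enough to absorb the factor 2 lost in the mean and to ensure 2s ≤ n + 1, so that the
  -- dilation τ/(2s) is covered by τ/(n + 1).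
  obtain ⟨n, hn⟩ := exists_nat_ge (4 * s)
  set τ := t (n + 1) with hτ
  have hτ1 : τ ∈ Ioc (0 : ℝ) 1 := ht1 (n + 1)
  have hmax : 0 < maximalFn f τ := mul_pos (inv_pos.2 hτ1.1) (psi_pos hf hτ1.1 hτ1.2)
  have h1 : maximalFn f τ / 2 ≤ rearr y (τ / 2) := by
    refine le_rearr_of_forall (aemeasurable_coe y) (half_pos hτ1.1) (half_lt_self hτ1.1)
      hτ1.2 ?_
    filter_upwards [hlow, ae_lam_mem] with u hu hu' huτ
    have h2 := (hκt u hu' (κ u)).1 rfl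
    have h3 : t (κ u) ≤ τ := by
      refine hanti (Nat.succ_le_of_lt ?_)
      by_contra! hc
      have h4 : κ u + 1 ≤ n + 1 := Nat.succ_le_succ hc
      exact absurd (huτ.2.trans (hanti h4)) (not_le.2 h2.1)
    have h4 := maximalFn_antitoneOn hfi (ht1 (κ u)) hτ1 h3
    exact (by linarith : maximalFn f τ / 2 ≤ y u).trans (le_abs_self _)
  have h2 := hdom (τ / 2) ⟨half_pos hτ1.1, by linarith [hτ1.1, hτ1.2]⟩
  have hn1 : (0 : ℝ) < (n : ℝ) + 1 := by positivity
  have h3 : s * rearr f (τ / 2 / s) ≤ s * rearr f (τ / (n + 1)) := by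
    rw [div_div]
    exact mul_rearr_div_mono f (by linarith) le_rfl (by linarith) (by linarith) hτ1.1
  have h4 := (ht n).2.2.2
  have h5 : 4 * s * rearr f (τ / (n + 1)) ≤ (n + 1) * rearr f (τ / (n + 1)) :=
    mul_le_mul_of_nonneg_right (by linarith) (rearr_nonneg _ _)
  linarith

lemma dominated_rearrL (f : L1) : Dominated f (rearrL f) :=
  ⟨1, le_rfl, fun t _ => by rw [rearr_rearrL, one_mul, div_one]⟩

lemma WeaklyRegular.of_averages {f : L1} (hf : f ≠ 0)
    (h : ∀ A : MeasurableSpace ℝ, IsSigmaSubalgebra A → Averages A (symIdeal f)) :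
    WeaklyRegular f := by
  by_contra hc
  obtain ⟨κ, hκ, hd⟩ := exists_not_dominated_condExp hf hc
  exact hd ((mem_symIdeal_iff hf).1 (h _ (isSigmaSubalgebra_comap hκ) (rearrL f)
    ((mem_symIdeal_iff hf).2 (dominated_rearrL f)) _ (isCondExp_condExpL1CLM hκ _)))

lemma WeaklyRegular.of_symIdeal_eq {f : L1} (hf : f ≠ 0) (h : symIdeal f = majIdeal f) :
    WeaklyRegular f := by
  by_contra hc
  obtain ⟨κ, hκ, hd⟩ := exists_not_dominated_condExp hf hc
  refine hd ((mem_symIdeal_iff hf).1 ?_)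
  rw [h]
  refine map_mem_majIdeal (isAdmissible_condExpL1CLM hκ) ?_
  rw [← h]
  exact (mem_symIdeal_iff hf).2 (dominated_rearrL f)

/-! ### Normability of the modular topology -/

lemma psi_smul (x : L1) (c t : ℝ) : psi (c • x : L1) t = |c| * psi x t := by
  rw [psi, psi, ← integral_const_mul, rearr_congr (Lp.coeFn_smul c x)]
  exact setIntegral_congr_fun measurableSet_Ioc fun u hu =>
    rearr_smul (aemeasurable_coe x) c hu.1

/-- The norm of the Marcinkiewicz space as a real number. -/
noncomputable def marcReal (f x : L1) : ℝ := ⨆ t : Ioc (0 : ℝ) 1, psi x t / psi f t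

/-- A real supremum defaults to 0 when unbounded, so this bound is what gives `marcReal` its meaning
on N_f. -/
lemma Dominated.bddAbove {f x : L1} (hf : f ≠ 0) (hx : Dominated f x) :
    BddAbove (range fun t : Ioc (0 : ℝ) 1 => psi x t / psi f t) := by
  obtain ⟨s, hs, hx⟩ := hx
  have hs0 : 0 < s := by linarith
  refine ⟨s * s, ?_⟩
  rintro _ ⟨⟨t, ht⟩, rfl⟩
  have h1 := Dominated.maximalFn_le hs hx ht
  have h2 : psi f (t / s) ≤ psi f t := psi_mono (L1.integrable_coeFn f) (div_pos ht.1 hs0).le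
    (div_le_self ht.1.le hs) ht.2
  change psi x t / psi f t ≤ s * s
  rw [div_le_iff₀ (psi_pos hf ht.1 ht.2)]
  rw [maximalFn, inv_mul_le_iff₀ ht.1] at h1
  calc psi x t ≤ t * (s * maximalFn f (t / s)) := h1
    _ = s * s * (t / s * maximalFn f (t / s)) := by field_simp
    _ = s * s * psi f (t / s) := by rw [mul_maximalFn f (div_pos ht.1 hs0)]
    _ ≤ s * s * psi f t := by gcongr

lemma Dominated.psi_le {f x : L1} (hf : f ≠ 0) (hx : Dominated f x) {t : ℝ}
    (ht : t ∈ Ioc (0 : ℝ) 1) : psi x t ≤ marcReal f x * psi f t := by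
  rw [← div_le_iff₀ (psi_pos hf ht.1 ht.2)]
  exact le_ciSup (hx.bddAbove hf) ⟨t, ht⟩

instance : Nonempty (Ioc (0 : ℝ) 1) := ⟨⟨1, one_pos, le_rfl⟩⟩

lemma marcReal_le {f x : L1} (hf : f ≠ 0) {C : ℝ}
    (h : ∀ t ∈ Ioc (0 : ℝ) 1, psi x t ≤ C * psi f t) : marcReal f x ≤ C :=
  ciSup_le fun t => (div_le_iff₀ (psi_pos hf t.2.1 t.2.2)).2 (h t t.2)

/-- The Marcinkiewicz norm on the principal symmetric ideal. -/
noncomputable def marcSeminorm {f : L1} (hf : f ≠ 0) : Seminorm ℝ (symIdeal f) :=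
  Seminorm.of (fun x => marcReal f x)
    (fun x y => by
      refine marcReal_le hf fun t ht => ?_
      have hx := ((mem_symIdeal_iff hf).1 x.2).psi_le hf ht
      have hy := ((mem_symIdeal_iff hf).1 y.2).psi_le hf ht
      rw [Submodule.coe_add, psi_congr (Lp.coeFn_add _ _), add_mul]
      exact (psi_add_le (L1.integrable_coeFn _) (L1.integrable_coeFn _) ht.1 ht.2).trans
        (add_le_add hx hy))
    (fun c x => by
      simp only [marcReal, Submodule.coe_smul, psi_smul, mul_div_assoc, Real.norm_eq_abs]
      rw [Real.mul_iSup_of_nonneg (abs_nonneg c)])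

lemma marcSeminorm_apply {f : L1} (hf : f ≠ 0) (x : symIdeal f) :
    marcSeminorm hf x = marcReal f x := rfl

lemma modular_lt_iff {f x : L1} {ε : ℝ≥0∞} : modular f x < ε ↔ ∃ s : ℝ, 0 < s ∧
    (∀ t ∈ Ioc (0 : ℝ) 1, rearr x t ≤ s * rearr f (t / max s s⁻¹)) ∧ ENNReal.ofReal s < ε := by
  simp only [modular, iInf_lt_iff, exists_prop]

lemma div_max_inv {s : ℝ} (hs : 0 < s) (hs1 : s ≤ 1) (t : ℝ) : t / max s s⁻¹ = s * t := by
  rw [max_eq_right (hs1.trans ((one_le_inv₀ hs).2 hs1)), div_inv_eq_mul, mul_comm]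

lemma psi_le_of_rearr_le_mul {f x : L1} {s : ℝ} (hs : s ∈ Ioc (0 : ℝ) 1)
    (h : ∀ t ∈ Ioc (0 : ℝ) 1, rearr x t ≤ s * rearr f (s * t)) {t : ℝ} (ht : t ∈ Ioc (0 : ℝ) 1) :
    psi x t ≤ psi f (s * t) := by
  have h2 := integral_rearr_mul f hs.1 ht.1.le
  have h3 : psi f (s * t) = ∫ u in Ioc 0 t, s * rearr f (s * u) := by
    rw [integral_const_mul, h2, mul_inv_cancel_left₀ hs.1.ne']
  rw [h3]
  refine integral_mono_of_nonneg (ae_of_all _ fun _ => rearr_nonneg _ _)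
    ((integrableOn_rearr_mul (L1.integrable_coeFn f) hs.1 ht.1.le
      (mul_le_one₀ hs.2 ht.1.le ht.2)).const_mul s) ?_
  exact (ae_restrict_iff' measurableSet_Ioc).2 (ae_of_all _ fun u hu =>
    h u ⟨hu.1, hu.2.trans ht.2⟩)

/-- Integrating x*(u) ≤ s f*(su) gives ψ_x(t) ≤ ψ_f(st) ≤ 2 s^r ψ_f(t), which is uniformly small
relative to ψ_f(t) as s → 0. -/
lemma Halving.exists_marcReal_lt {f : L1} (hf : f ≠ 0) (h : Halving f) {ε : ℝ} (hε : 0 < ε) :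
    ∃ η > (0 : ℝ), ∀ x : L1, modular f x < ENNReal.ofReal η → marcReal f x < ε := by
  obtain ⟨r, hr, h⟩ := h.power_bound
  have hlim : Tendsto (fun s : ℝ => 2 * s ^ r) (𝓝[>] 0) (𝓝 0) := by
    have : ContinuousAt (fun s : ℝ => 2 * s ^ r) 0 :=
      continuousAt_const.mul (Real.continuousAt_rpow_const _ _ (Or.inr hr.1.le))
    have h0 := this.tendsto
    rw [Real.zero_rpow hr.1.ne', mul_zero] at h0
    exact h0.mono_left nhdsWithin_le_nhds
  obtain ⟨η, hη, hsub⟩ := mem_nhdsGT_iff_exists_Ioo_subset.1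
    ((hlim.eventually (gt_mem_nhds hε)).and (Ioo_mem_nhdsGT (zero_lt_one' ℝ)))
  refine ⟨η, hη, fun x hx => ?_⟩
  obtain ⟨s, hs, hx, hsη⟩ := modular_lt_iff.1 hx
  obtain ⟨h1, h2⟩ := hsub ⟨hs, (ENNReal.ofReal_lt_ofReal_iff hη).1 hsη⟩
  have hs1 : s ∈ Ioc (0 : ℝ) 1 := ⟨hs, h2.2.le⟩
  simp only [div_max_inv hs hs1.2] at hx
  exact (marcReal_le hf fun t ht =>
    (psi_le_of_rearr_le_mul hs1 hx ht).trans (h s hs1 t ht)).trans_lt h1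

/-- From x* ≤ x** ≤ η f** ≤ ηK f* + ηM, each summand is made at most (s/2) f*(st): the first because
f* decreases, the second because s ≤ δ keeps f*(st) ≥ f*(δ) > 0. -/
lemma RegularNearZero.exists_modular_le {f : L1} (hf : f ≠ 0) (h : RegularNearZero f)
    {ε : ℝ≥0∞} (hε : 0 < ε) :
    ∃ η > (0 : ℝ), ∀ x : L1, Dominated f x → marcReal f x < η → modular f x ≤ ε := by
  have hfm := aemeasurable_coe f
  obtain ⟨K, M, hK, hM, h⟩ := h.maximalFn_le
  obtain ⟨δ, hδ, hfδ⟩ := exists_rearr_pos hf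
  obtain ⟨s, hs, hsδ, hsε⟩ : ∃ s : ℝ, 0 < s ∧ s ≤ δ ∧ ENNReal.ofReal s ≤ ε := by
    rcases eq_or_ne ε ∞ with rfl | hε'
    · exact ⟨δ, hδ.1, le_rfl, le_top⟩
    · refine ⟨min δ ε.toReal, lt_min hδ.1 (ENNReal.toReal_pos hε.ne' hε'), min_le_left _ _, ?_⟩
      exact ENNReal.ofReal_le_of_le_toReal (min_le_right _ _)
  have hs1 : s ≤ 1 := hsδ.trans hδ.2.le
  set η := min (s / (2 * (K + 1))) (s * rearr f δ / (2 * (M + 1))) with hη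
  have hη0 : 0 < η := lt_min (by positivity) (by positivity)
  have hηK : η * K ≤ s / 2 := by
    have h1 : η * (2 * (K + 1)) ≤ s := (le_div_iff₀ (by positivity)).1 (min_le_left _ _)
    linarith
  have hηM : η * M ≤ s / 2 * rearr f δ := by
    have h1 : η * (2 * (M + 1)) ≤ s * rearr f δ :=
      (le_div_iff₀ (by positivity)).1 (min_le_right _ _)
    linarith
  refine ⟨η, hη0, fun x hx hxη => le_trans (iInf_le_of_le s (iInf_le_of_le hs (iInf_le_of_le ?_
    le_rfl))) hsε⟩
  intro t ht
  rw [div_max_inv hs hs1]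
  have hst : 0 < s * t := mul_pos hs ht.1
  have h1 : rearr f t ≤ rearr f (s * t) :=
    rearr_antitone hfm hst (mul_le_of_le_one_left ht.1.le hs1)
  have h2 : rearr f δ ≤ rearr f (s * t) :=
    rearr_antitone hfm hst ((mul_le_of_le_one_right hs.le ht.2).trans hsδ)
  have h3 : maximalFn x t ≤ η * maximalFn f t := by
    have h4 := (hx.psi_le hf ht).trans (mul_le_mul_of_nonneg_right hxη.le (psi_nonneg f t))
    rw [maximalFn, inv_mul_le_iff₀ ht.1, mul_left_comm, mul_maximalFn f ht.1]
    exact h4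
  calc rearr x t ≤ maximalFn x t := rearr_le_maximalFn (L1.integrable_coeFn x) ht.1 ht.2
    _ ≤ η * (K * rearr f t + M) := h3.trans (mul_le_mul_of_nonneg_left (h t ht) hη0.le)
    _ = η * K * rearr f t + η * M := by ring
    _ ≤ s / 2 * rearr f (s * t) + s / 2 * rearr f (s * t) := by
        refine add_le_add (mul_le_mul hηK h1 (rearr_nonneg _ _) (by linarith)) (hηM.trans ?_)
        gcongr
    _ = s * rearr f (s * t) := by ring

lemma RegularNearZero.modularNormable {f : L1} (hf : f ≠ 0) (h : RegularNearZero f) :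
    ModularNormable f := by
  refine ⟨marcSeminorm hf, fun x hx => ?_, le_antisymm ?_ ?_⟩
  · by_contra hx0
    have hx0' : (x : L1) ≠ 0 := fun h => hx0 (Subtype.ext h)
    have h1 := ((mem_symIdeal_iff hf).1 x.2).psi_le hf ⟨one_pos, le_rfl⟩
    rw [marcSeminorm_apply] at hx
    rw [hx, zero_mul] at h1
    exact absurd (psi_pos hx0' one_pos le_rfl) (not_lt.2 h1)
  · refine tendsto_iff_comap.1 (ENNReal.tendsto_nhds_zero.2 fun ε hε => ?_)
    obtain ⟨η, hη, hx⟩ := h.exists_modular_le hf hε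
    refine eventually_comap.2 ((gt_mem_nhds hη).mono ?_)
    rintro _ ha x rfl
    exact hx x ((mem_symIdeal_iff hf).1 x.2) ha
  · refine tendsto_iff_comap.1 (Metric.tendsto_nhds.2 fun ε hε => ?_)
    obtain ⟨η, hη, hx⟩ := (h.halving hf).exists_marcReal_lt hf hε
    refine eventually_comap.2 ((gt_mem_nhds (ENNReal.ofReal_pos.2 hη)).mono ?_)
    rintro _ ha x rfl
    rw [Real.dist_0_eq_abs, abs_of_nonneg (apply_nonneg _ _)]
    exact hx x ha

/-! ### Cyclic shifts of step functions, and halving from a norm -/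

lemma sum_toL1 {ι : Type*} (s : Finset ι) {g : ι → ℝ → ℝ} (hg : ∀ i, Integrable (g i) lam) :
    ((∑ i ∈ s, (hg i).toL1 (g i) : L1) : ℝ → ℝ) =ᵐ[lam] fun u => ∑ i ∈ s, g i u := by
  classical
  induction s using Finset.induction_on with
  | empty =>
    simp only [Finset.sum_empty]
    exact Lp.coeFn_zero ℝ 1 lam
  | insert i s hi ih =>
    rw [Finset.sum_insert hi]
    filter_upwards [Lp.coeFn_add ((hg i).toL1 (g i)) (∑ i ∈ s, (hg i).toL1 (g i)), ih,
      (hg i).coeFn_toL1] with u h1 h2 h3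
    rw [h1, Pi.add_apply, h2, h3, Finset.sum_insert hi]

/-- The index of the block of length `t / (m + 1)` of `(0, t]` that contains `u`. -/
noncomputable def blockIndex (t : ℝ) (m : ℕ) (u : ℝ) : Fin (m + 1) :=
  Fin.ofNat (m + 1) (⌈u * (m + 1) / t⌉₊ - 1)

lemma measurable_blockIndex (t : ℝ) (m : ℕ) : Measurable (blockIndex t m) := by
  have h1 : Measurable fun u : ℝ => ⌈u * (m + 1) / t⌉₊ :=
    Nat.measurable_ceil.comp (by fun_prop)
  have h2 : Measurable fun k : ℕ => Fin.ofNat (m + 1) (k - 1) := Measurable.of_discrete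
  exact h2.comp h1

lemma mem_block {t : ℝ} (ht : 0 < t) {m : ℕ} {u : ℝ} (hu : u ∈ Ioc 0 t) :
    u ∈ Ioc ((blockIndex t m u : ℝ) * (t / (m + 1)))
      ((blockIndex t m u : ℝ) * (t / (m + 1)) + t / (m + 1)) := by
  have hm : (0 : ℝ) < m + 1 := by positivity
  set q := ⌈u * (m + 1) / t⌉₊ with hq
  have hpos : 0 < u * (m + 1) / t := div_pos (mul_pos hu.1 hm) ht
  have h1 : 0 < q := Nat.ceil_pos.2 hpos
  have h2 : q ≤ m + 1 := by
    refine Nat.ceil_le.2 ?_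
    rw [div_le_iff₀ ht]
    push_cast
    nlinarith [hu.2]
  have h3 : ((blockIndex t m u : ℕ) : ℝ) = q - 1 := by
    have : (blockIndex t m u : ℕ) = q - 1 := by
      change (q - 1) % (m + 1) = q - 1
      exact Nat.mod_eq_of_lt (by omega)
    rw [this, Nat.cast_sub h1, Nat.cast_one]
  have h4 : u * (m + 1) / t ≤ q := Nat.le_ceil _
  have h5 : (q : ℝ) - 1 < u * (m + 1) / t := by
    have := Nat.ceil_lt_add_one hpos.le
    linarith
  rw [h3]
  rw [div_le_iff₀ ht] at h4
  rw [lt_div_iff₀ ht] at h5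
  constructor
  · rw [← mul_div_assoc, div_lt_iff₀ hm]
    exact h5
  · rw [← add_one_mul, sub_add_cancel, ← mul_div_assoc, le_div_iff₀ hm]
    exact h4

lemma card_filter_lt_le (m : ℕ) {r : ℝ} (hr : 0 ≤ r) :
    (((Finset.univ : Finset (Fin (m + 1))).filter
      fun i : Fin (m + 1) => ((i : ℕ) : ℝ) + 1 < r).card : ℝ) ≤ r := by
  refine le_trans ?_ (Nat.floor_le hr)
  refine Nat.cast_le.2 ?_
  rw [← Finset.card_range ⌊r⌋₊]
  refine Finset.card_le_card_of_injOn (fun i => (i : ℕ)) (fun i hi => ?_) fun i _ j _ h => Fin.ext h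
  have h1 : ((i : ℕ) : ℝ) + 1 < r := (Finset.mem_filter.1 hi).2
  have h2 : (i : ℕ) + 1 ≤ ⌊r⌋₊ := Nat.le_floor (by push_cast; exact h1.le)
  simp only [Finset.coe_range, mem_Iio]
  omega

/-- The step function on the blocks of `(0, t]` with the values `b`, shifted cyclically by `j`. -/
noncomputable def blockStep (t : ℝ) (m : ℕ) (b : Fin (m + 1) → ℝ) (j : Fin (m + 1)) : ℝ → ℝ :=
  indicator (Ioc 0 t) fun u => b (blockIndex t m u + j)

lemma measurable_blockStep (t : ℝ) (m : ℕ) (b : Fin (m + 1) → ℝ) (j : Fin (m + 1)) :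
    Measurable (blockStep t m b j) := by
  have h : Measurable fun i : Fin (m + 1) => b (i + j) := Measurable.of_discrete
  exact (h.comp (measurable_blockIndex t m)).indicator measurableSet_Ioc

lemma abs_blockStep_le (t : ℝ) (m : ℕ) (b : Fin (m + 1) → ℝ) (j : Fin (m + 1)) (u : ℝ) :
    |blockStep t m b j u| ≤ ∑ i, |b i| := by
  by_cases hu : u ∈ Ioc 0 t
  · rw [blockStep, indicator_of_mem hu]
    exact Finset.single_le_sum (f := fun i => |b i|) (fun i _ => abs_nonneg _)
      (Finset.mem_univ _)
  · rw [blockStep, indicator_of_notMem hu, abs_zero]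
    exact Finset.sum_nonneg fun i _ => abs_nonneg _

/-- For fixed u, adding the block index of u permutes the shifts. -/
lemma sum_blockStep {t u : ℝ} (m : ℕ) (b : Fin (m + 1) → ℝ) (hu : u ∈ Ioc 0 t) :
    ∑ j, blockStep t m b j u = ∑ i, b i := by
  simp only [blockStep, indicator_of_mem hu]
  exact Equiv.sum_comp (Equiv.addLeft (blockIndex t m u)) b

/-- A step function whose values are those of an antitone function `h` at the right endpoints of
the blocks, in any cyclic order, has a rearrangement below `h`. -/
lemma rearr_blockStep_le {t : ℝ} (ht : 0 < t) (m : ℕ) {h : ℝ → ℝ} (hh : ∀ u, 0 ≤ h u)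
    (hanti : AntitoneOn h (Ioi 0)) (j : Fin (m + 1)) {v : ℝ} (hv : 0 < v) :
    rearr (blockStep t m (fun i => h (((i : ℕ) + 1) * (t / (m + 1)))) j) v ≤ h v := by
  set ℓ := t / (m + 1) with hℓ
  have hℓ0 : 0 < ℓ := div_pos ht (by positivity)
  set b : Fin (m + 1) → ℝ := fun i => h (((i : ℕ) + 1) * ℓ) with hb
  set S := (Finset.univ : Finset (Fin (m + 1))).filter fun i : Fin (m + 1) =>
    ((i : ℕ) : ℝ) + 1 < v / ℓ with hS
  -- The step function can exceed h(v) only on blocks whose value is taken at an endpoint below v.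
  -- There are at most v/ℓ such values, and the cyclic shift preserves their number.
  set S' := S.map (Equiv.subRight j).toEmbedding with hS'
  refine rearr_le_of_measure_le (hh v) ?_
  have hsub : {u | h v < |blockStep t m b j u|} ⊆
      ⋃ i ∈ S', Ioc ((i : ℕ) * ℓ) ((i : ℕ) * ℓ + ℓ) := by
    intro u hu
    have hut : u ∈ Ioc 0 t := by
      by_contra hc
      rw [mem_ofPred_eq, blockStep, indicator_of_notMem hc, abs_zero] at hu
      exact absurd hu (not_lt.2 (hh v))
    rw [mem_ofPred_eq, blockStep, indicator_of_mem hut, abs_of_nonneg (hh _)] at hu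
    refine mem_iUnion₂.2 ⟨blockIndex t m u, ?_, mem_block ht hut⟩
    rw [hS', Finset.mem_map_equiv, Equiv.subRight_symm_apply, hS, Finset.mem_filter]
    refine ⟨Finset.mem_univ _, ?_⟩
    rw [lt_div_iff₀ hℓ0]
    by_contra! hc
    exact absurd (hanti hv (hv.trans_le hc) hc) (not_le.2 hu)
  calc lam {u | h v < |blockStep t m b j u|}
      ≤ ∑ i ∈ S', lam (Ioc ((i : ℕ) * ℓ) ((i : ℕ) * ℓ + ℓ)) :=
        (measure_mono hsub).trans (measure_biUnion_finset_le _ _)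
    _ ≤ ∑ i ∈ S', ENNReal.ofReal ℓ := by
        refine Finset.sum_le_sum fun i _ => (Measure.restrict_apply_le _ _).trans ?_
        rw [Real.volume_Ioc, add_sub_cancel_left]
    _ = ENNReal.ofReal (S.card * ℓ) := by
        rw [Finset.sum_const, hS', Finset.card_map, nsmul_eq_mul,
          ENNReal.ofReal_mul (Nat.cast_nonneg _), ENNReal.ofReal_natCast]
    _ ≤ ENNReal.ofReal v := by
        refine ENNReal.ofReal_le_ofReal ?_
        rw [← le_div_iff₀ hℓ0]
        exact card_filter_lt_le m (div_pos hv hℓ0).le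

/-- A lower Riemann sum for `∫₀ᵗ s f*(su) du = ψ_f(st)`. -/
lemma psi_sub_le_sum (f : L1) {s t : ℝ} (hs : s ∈ Ioc (0 : ℝ) 1) (ht : t ∈ Ioc (0 : ℝ) 1) (m : ℕ) :
    psi f (s * t) - psi f (s * (t / (m + 1))) ≤
      t / (m + 1) * ∑ i : Fin (m + 1), s * rearr f (s * (((i : ℕ) + 1) * (t / (m + 1)))) := by
  have hm : (0 : ℝ) < m + 1 := by positivity
  set ℓ := t / (m + 1) with hℓ
  have hℓ0 : 0 < ℓ := div_pos ht.1 hm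
  have htℓ : ((m : ℝ) + 1) * ℓ = t := by rw [hℓ, mul_div_cancel₀ _ hm.ne']
  have hst : s * t ≤ 1 := mul_le_one₀ hs.2 ht.1.le ht.2
  -- F telescopes from ψ(sℓ) to ψ(st). Its increment from k to k + 1 is bounded by the value at the
  -- right end of block k, so the first block is lost and the last term of the sum is spare.
  set F : ℕ → ℝ := fun k => psi f (s * (((k : ℝ) + 1) * ℓ)) with hF
  have hstep : ∀ k ∈ Finset.range m,
      F (k + 1) - F k ≤ ℓ * (s * rearr f (s * (((k : ℝ) + 1) * ℓ))) := by
    intro k hk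
    have hk1 : ((k : ℝ) + 1) + 1 ≤ m + 1 := by
      have : k + 1 ≤ m := Finset.mem_range.1 hk
      exact_mod_cast Nat.succ_le_succ this
    have h0 : 0 < s * (((k : ℝ) + 1) * ℓ) := mul_pos hs.1 (by positivity)
    have h1 : s * (((k : ℝ) + 1) * ℓ) ≤ s * (((k : ℝ) + 1 + 1) * ℓ) := by
      have := hs.1
      gcongr
      linarith
    have h2 : s * (((k : ℝ) + 1 + 1) * ℓ) ≤ 1 := by
      refine le_trans (mul_le_mul_of_nonneg_left ?_ hs.1.le) hst
      rw [← htℓ]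
      gcongr
    have h3 := psi_le_psi_add (L1.integrable_coeFn f) h0 h1 h2
    have h4 : F (k + 1) = psi f (s * (((k : ℝ) + 1 + 1) * ℓ)) := by
      simp only [hF]
      push_cast
      rfl
    rw [h4, sub_le_iff_le_add']
    refine h3.trans_eq ?_
    simp only [hF]
    ring
  have h1 := Finset.sum_le_sum hstep
  rw [Finset.sum_range_sub, ← Finset.mul_sum] at h1
  have h2 : F m = psi f (s * t) := by simp only [hF, htℓ]
  have h3 : F 0 = psi f (s * ℓ) := by simp [hF]
  rw [h2, h3] at h1
  refine h1.trans (mul_le_mul_of_nonneg_left ?_ hℓ0.le)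
  rw [Fin.sum_univ_eq_sum_range (fun k => s * rearr f (s * (((k : ℝ) + 1) * ℓ))) (m + 1),
    Finset.sum_range_succ]
  exact le_add_of_nonneg_right (mul_nonneg hs.1.le (rearr_nonneg _ _))

/-- The norm satisfies the triangle inequality, so it cannot tell that averaging the equimeasurable
shifts spreads their mass over (0, t]. The multiple Y of their mean has modular r < 1, so its
constant value on (0, t] is at most r f*(rt/2), and (t/2) r f*(rt/2) ≤ ψ(t). -/
lemma ModularNormable.halving {f : L1} (hf : f ≠ 0) (h : ModularNormable f) : Halving f := by
  have hfi := L1.integrable_coeFn f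
  obtain ⟨p, -, hp⟩ := h
  obtain ⟨c, hc, hpn⟩ : ∃ c > (0 : ℝ), ∀ x : symIdeal f, p x < c → modular f x < 1 := by
    have h1 : {x : symIdeal f | modular f x < 1} ∈
        comap (fun x : symIdeal f => modular f (x : L1)) (𝓝 0) :=
      preimage_mem_comap (gt_mem_nhds one_pos)
    rw [← hp] at h1
    obtain ⟨c, hc, hsub⟩ := (Metric.nhds_basis_ball.comap _).mem_iff.1 h1
    refine ⟨c, hc, fun x hx => hsub ?_⟩
    rw [mem_preimage, mem_ball_zero_iff, Real.norm_of_nonneg (apply_nonneg p x)]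
    exact hx
  obtain ⟨η, hη, hnp⟩ : ∃ η > (0 : ℝ≥0∞), ∀ x : symIdeal f, modular f x < η → p x < c / 8 := by
    have h1 : {x : symIdeal f | p x < c / 8} ∈ comap (fun x : symIdeal f => p x) (𝓝 0) :=
      preimage_mem_comap (gt_mem_nhds (by positivity))
    rw [hp] at h1
    obtain ⟨η, hη, hsub⟩ := (ENNReal.nhds_zero_basis.comap _).mem_iff.1 h1
    exact ⟨η, hη, fun x hx => hsub hx⟩
  obtain ⟨s, hs, hsη⟩ : ∃ s ∈ Ioo (0 : ℝ) 1, ENNReal.ofReal s < η := by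
    have h1 : Tendsto ENNReal.ofReal (𝓝[>] 0) (𝓝 0) := by
      simpa using (ENNReal.continuous_ofReal.tendsto 0).mono_left
        (nhdsWithin_le_nhds (s := Ioi (0 : ℝ)))
    obtain ⟨s, hs, hs'⟩ := ((h1.eventually (gt_mem_nhds hη)).and
      (Ioo_mem_nhdsGT (zero_lt_one' ℝ))).exists
    exact ⟨s, hs', hs⟩
  have hs1 : s ∈ Ioc (0 : ℝ) 1 := ⟨hs.1, hs.2.le⟩
  refine ⟨s, hs, fun t ht => ?_⟩
  have hst : s * t ∈ Ioc (0 : ℝ) 1 := ⟨mul_pos hs.1 ht.1, mul_le_one₀ hs.2.le ht.1.le ht.2⟩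
  have hψ := psi_pos hf hst.1 hst.2
  -- The mesh is so fine that the first block, missed by the Riemann sum, carries at most half of
  -- ψ(st).
  obtain ⟨m, hm⟩ : ∃ m : ℕ, psi f (s * (t / (m + 1))) ≤ psi f (s * t) / 2 := by
    obtain ⟨δ, hδ, hδψ⟩ := exists_psi_le hfi (half_pos hψ)
    obtain ⟨m, hm⟩ := exists_nat_one_div_lt hδ.1
    have hm0 : (0 : ℝ) < m + 1 := by positivity
    refine ⟨m, hδψ _ ⟨mul_nonneg hs.1.le (div_pos ht.1 hm0).le, ?_⟩⟩
    rw [← mul_div_assoc]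
    exact (div_le_div_of_nonneg_right hst.2 hm0.le).trans hm.le
  have hm0 : (0 : ℝ) < m + 1 := by positivity
  set h : ℝ → ℝ := fun u => s * rearr f (s * u) with hh
  have hh0 : ∀ u, 0 ≤ h u := fun u => mul_nonneg hs.1.le (rearr_nonneg _ _)
  have hanti : AntitoneOn h (Ioi 0) := fun a ha b hb hab =>
    mul_le_mul_of_nonneg_left (rearr_antitone (aemeasurable_coe f) (mul_pos hs.1 ha)
      (mul_le_mul_of_nonneg_left hab hs.1.le)) hs.1.le
  set b : Fin (m + 1) → ℝ := fun i => h (((i : ℕ) + 1) * (t / (m + 1))) with hb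
  have hi : ∀ j, Integrable (blockStep t m b j) lam := fun j =>
    Integrable.mono' (integrable_const _) (measurable_blockStep t m b j).aestronglyMeasurable
      (ae_of_all _ (abs_blockStep_le t m b j))
  have hmem : ∀ j, (hi j).toL1 _ ∈ symIdeal f := fun j => (mem_symIdeal_iff hf).2 <| by
    have hb0 : 0 ≤ ∑ i, |b i| := Finset.sum_nonneg fun i _ => abs_nonneg (b i)
    refine dominated_of_bound hf hb0 fun v _ => ?_
    rw [rearr_congr (hi j).coeFn_toL1]
    exact rearr_le_of_ae_le hb0
      (ae_of_all _ (abs_blockStep_le t m b j)) v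
  set X : Fin (m + 1) → symIdeal f := fun j => ⟨(hi j).toL1 _, hmem j⟩ with hX
  have hpX : ∀ j, p (X j) < c / 8 := fun j => by
    refine hnp _ (modular_lt_iff.2 ⟨s, hs.1, fun v hv => ?_, hsη⟩)
    rw [div_max_inv hs.1 hs.2.le, rearr_congr (hi j).coeFn_toL1]
    exact rearr_blockStep_le ht.1 m hh0 hanti j hv.1
  -- Of the factor 8, one 2 is spent on evaluating at t/2 and another on the lost first block; the
  -- remaining 2 after the conclusion 2ψ(st) ≤ ψ(t) is exactly the halving.
  set Y : symIdeal f := (8 / ((m : ℝ) + 1)) • ∑ j, X j with hY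
  have hpY : p Y < c := by
    have h1 : p (∑ j, X j) ≤ ∑ j, p (X j) :=
      Finset.le_sum_of_subadditive p (map_zero p).le (map_add_le_add p) _ _
    have h2 : ∑ j, p (X j) < ∑ _j : Fin (m + 1), c / 8 :=
      Finset.sum_lt_sum_of_nonempty Finset.univ_nonempty fun j _ => hpX j
    rw [Finset.sum_const, Finset.card_univ, Fintype.card_fin, nsmul_eq_mul] at h2
    push_cast at h2
    rw [hY, map_smul_eq_mul, Real.norm_of_nonneg (by positivity)]
    calc 8 / ((m : ℝ) + 1) * p (∑ j, X j) < 8 / ((m : ℝ) + 1) * ((m + 1) * (c / 8)) :=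
          mul_lt_mul_of_pos_left (h1.trans_lt h2) (by positivity)
      _ = c := by field_simp
  have hYae : ∀ᵐ u ∂lam, u ∈ Ioc 0 t → (Y : L1) u = 8 / ((m : ℝ) + 1) * ∑ i, b i := by
    have h1 : (Y : L1) = (8 / ((m : ℝ) + 1)) • ∑ j, (hi j).toL1 _ := by
      rw [hY, Submodule.coe_smul, Submodule.coe_sum]
    rw [h1]
    filter_upwards [Lp.coeFn_smul (8 / ((m : ℝ) + 1)) (∑ j, (hi j).toL1 _),
      sum_toL1 Finset.univ hi] with u h2 h3 hu
    rw [h2, Pi.smul_apply, h3, smul_eq_mul, sum_blockStep m b hu]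
  obtain ⟨r, hr, hYr, hr1⟩ := modular_lt_iff.1 (hpn Y hpY)
  have hr1' : r < 1 := by simpa using hr1
  simp only [div_max_inv hr hr1'.le] at hYr
  have ht2 : t / 2 ∈ Ioc (0 : ℝ) 1 := ⟨half_pos ht.1, by linarith [ht.1, ht.2]⟩
  have h1 : 8 / ((m : ℝ) + 1) * ∑ i, b i ≤ rearr (Y : L1) (t / 2) :=
    le_rearr_of_forall (aemeasurable_coe _) ht2.1 (half_lt_self ht.1) ht.2
      (hYae.mono fun u hu hu' => (hu hu').symm.le.trans (le_abs_self _))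
  have hrt : r * (t / 2) ∈ Ioc (0 : ℝ) 1 :=
    ⟨mul_pos hr ht2.1, mul_le_one₀ hr1'.le ht2.1.le ht2.2⟩
  have hrt' : r * (t / 2) ≤ t :=
    (mul_le_of_le_one_left ht2.1.le hr1'.le).trans (half_le_self ht.1.le)
  have h2 : t / 2 * (r * rearr f (r * (t / 2))) ≤ psi f t := by
    calc t / 2 * (r * rearr f (r * (t / 2))) = r * (t / 2) * rearr f (r * (t / 2)) := by ring
      _ ≤ psi f (r * (t / 2)) := mul_rearr_le_psi hfi hrt.1.le hrt.2
      _ ≤ psi f t := psi_mono hfi hrt.1.le hrt' ht.2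
  have h3 := mul_le_mul_of_nonneg_left (h1.trans (hYr _ ht2)) ht2.1.le
  have h4 := psi_sub_le_sum f hs1 ht m
  have h5 : t / 2 * (8 / ((m : ℝ) + 1) * ∑ i, b i) = 4 * (t / (m + 1) * ∑ i, b i) := by
    field_simp
    ring
  have h6 : psi f (s * t) - psi f (s * (t / (m + 1))) ≤ t / (m + 1) * ∑ i, b i := h4
  linarith

end MeklerIdeals

theorem theorem1p4 (f : MeklerIdeals.L1) (hf : f ≠ 0) :
    List.TFAE [
      -- the modular topology on `N_f` is normable
      MeklerIdeals.ModularNormable f,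
      -- `N_f = M_f`
      MeklerIdeals.symIdeal f = MeklerIdeals.majIdeal f,
      -- every `σ`-subalgebra averages `N_f`
      ∀ A : MeasurableSpace ℝ, MeklerIdeals.IsSigmaSubalgebra A →
        MeklerIdeals.Averages A (MeklerIdeals.symIdeal f),
      -- `f** ∈ N_f`
      ∃ g ∈ MeklerIdeals.symIdeal f, (g : ℝ → ℝ) =ᵐ[MeklerIdeals.lam] MeklerIdeals.maximalFn f,
      -- `f** ≤ K f*` near zero
      ∃ K > (0 : ℝ), ∃ δ > (0 : ℝ), ∀ t ∈ Ioo (0 : ℝ) δ,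
        MeklerIdeals.maximalFn f t ≤ K * MeklerIdeals.rearr f t,
      -- the power bound for the dilations on the Marcinkiewicz space
      ∃ k > (0 : ℝ), ∃ p ∈ Ioo (0 : ℝ) 1, ∀ s ∈ Ioc (0 : ℝ) 1,
        MeklerIdeals.dilNorm f s ≤ ENNReal.ofReal (k * s ^ (-p)),
      -- the doubling condition; the quotient lies between `1` and `2` for small `t`
      1 < liminf (fun t : ℝ => MeklerIdeals.psi f (2 * t) / MeklerIdeals.psi f t) (𝓝[>] 0)] ∧
    -- `f** ≤ K f*` on the whole interval
    ((∃ K > (0 : ℝ), ∀ t ∈ Ioo (0 : ℝ) 1,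
        MeklerIdeals.maximalFn f t ≤ K * MeklerIdeals.rearr f t) ↔
      (∃ g ∈ MeklerIdeals.symIdeal f, (g : ℝ → ℝ) =ᵐ[MeklerIdeals.lam] MeklerIdeals.maximalFn f) ∧
        ∃ m > (0 : ℝ), ∀ᵐ u ∂MeklerIdeals.lam, m ≤ |f u|) := by
  have h54 : MeklerIdeals.RegularNearZero f ↔ ∃ g ∈ MeklerIdeals.symIdeal f,
      (g : ℝ → ℝ) =ᵐ[MeklerIdeals.lam] MeklerIdeals.maximalFn f :=
    ⟨fun h => h.exists_eq_maximalFn hf,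
      fun h => (MeklerIdeals.WeaklyRegular.of_eq_maximalFn hf h).regularNearZero⟩
  refine ⟨?_, by rw [MeklerIdeals.forall_maximalFn_le_iff hf, h54]⟩
  tfae_have 1 → 5 := fun h => (h.halving hf).regularNearZero
  tfae_have 5 → 1 := fun h => MeklerIdeals.RegularNearZero.modularNormable hf h
  tfae_have 2 → 5 := fun h => (MeklerIdeals.WeaklyRegular.of_symIdeal_eq hf h).regularNearZero
  tfae_have 5 → 2 := fun h => MeklerIdeals.RegularNearZero.symIdeal_eq_majIdeal hf h
  tfae_have 3 → 5 := fun h => (MeklerIdeals.WeaklyRegular.of_averages hf h).regularNearZero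
  tfae_have 5 → 3 := fun h A hA => MeklerIdeals.RegularNearZero.averages hf h hA
  tfae_have 5 ↔ 4 := h54
  tfae_have 5 ↔ 6 := (MeklerIdeals.regularNearZero_iff_halving hf).trans
    (MeklerIdeals.halving_iff_dilNorm hf)
  tfae_have 5 ↔ 7 := MeklerIdeals.regularNearZero_iff_liminf hf
  tfae_finish
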